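/- Let $c>0$ and let $\alpha,\beta\in C^3((0,\infty))$ be real-valued. On $\mathbb{R}\times(\mathbb{R}^3\setminus\{0\})$ consider the spherically symmetric static Lorentzian metric $$g=-e^{2\alpha(r)}c^2\,dt^2+e^{2\beta(r)}\,dr^2+r^2(d\theta^2+\sin^2\theta\,d\phi^2),$$ where $r=|x|$ for $x\in\mathbb{R}^3$, with volume element $d\operatorname{vol}_g=c\,e^{\alpha+\beta}\,dt\,dx$ and Einstein tensor $G^\mu{}_\nu=R^\mu{}_\nu-\tfrac12R\,\delta^\mu{}_\nu$. The components $G^t{}_t$, $G^r{}_r$, $G^\theta{}_\theta$ in the coordinates $(t,r,\theta,\phi)$ are functions of $r$ alone. We say that the *weak Bianchi identity* holds if for every smooth compactly supported vector field $\psi$ on $\mathbb{R}^4$ $$\int_{\mathbb{R}^4}G^\mu{}_\nu\,\nabla_\mu\psi^\nu\,d\operatorname{vol}_g=0.$$ Here the integrand may be singular on the axis $\{r=0\}$, and the integral is understood as the limit, as $\varepsilon\downarrow0$, of the integrals over $\Omega_\varepsilon=\{(t,x)\in\mathbb{R}^4:|x|\ge\varepsilon\}$, each of which is required to converge absolutely;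 moreover, whenever the integrand is Lebesgue integrable on $\mathbb{R}^4$, its Lebesgue integral over $\mathbb{R}^4$ is required to vanish. 1. Suppose that, as $r\downarrow0$, $$r^3\big(|G^t{}_t|+|G^r{}_r|+|G^\theta{}_\theta|\big)e^{\alpha+\beta}=O(r^\gamma)\quad\text{for some }\gamma>0,\tag{1}$$ $$\lim_{\varepsilon\downarrow0}\varepsilon^3\,G^r{}_r(\varepsilon)\,\|e^{\alpha+\beta}\|_{L^\infty((0,\varepsilon])}=0.\tag{2}$$ Then the weak Bianchi identity holds. (In (2) the norm may be $+\infty$; the convention is $0\cdot\infty=0$.) 2. For each $\gamma>0$, the bound in (1) holds with exponent $\gamma$ if and only if, as $r\downarrow0$, $$r e^{\alpha-\beta}\,(1-e^{2\beta}-2r\beta')=O(r^\gamma),\tag{3}$$ $$r e^{\alpha-\beta}\,(1-e^{2\beta}+2r\alpha')=O(r^\gamma),\tag{4}$$ $$r^2e^{\alpha-\beta}\,\big[(1+r\alpha')(\alpha'-\beta')+r\alpha''\big]=O(r^\gamma).\tag{5}$$ In particular, if (3)–(5) hold for some $\gamma>0$ and (2) holds, then the weak Bianchi identity holds. 3. If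 (4) holds for some $\gamma>0$ and $\alpha+\beta$ is decreasing as $r\downarrow0$ (that is, $r\mapsto\alpha(r)+\beta(r)$ is nondecreasing on $(0,\delta]$ for some $\delta>0$), then (2) holds. -/

import Mathlib

open Set Filter Topology MeasureTheory

noncomputable section

namespace StaticBianchi

/-- Coordinate space `ℝ⁴`, used both for Cartesian coordinates `(t, x¹, x², x³)` and for
spherical coordinates `(t, r, θ, φ)`. -/
abbrev Coord : Type := Fin 4 → ℝ

/-- The components `g_{μν}` of a metric in a coordinate system. -/
abbrev MetricField : Type := Coord → Matrix (Fin 4) (Fin 4) ℝ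

/-- Partial derivative `∂_μ f`. -/
def pd (μ : Fin 4) (f : Coord → ℝ) (x : Coord) : ℝ := fderiv ℝ f x (Pi.single μ 1)

/-- Christoffel symbols `Γ^ρ_{μν}` of the Levi-Civita connection. -/
def christoffel (g : MetricField) (ρ μ ν : Fin 4) (x : Coord) : ℝ :=
  (1 / 2) * ∑ σ, (g x)⁻¹ ρ σ *
    (pd μ (fun y => g y ν σ) x + pd ν (fun y => g y μ σ) x - pd σ (fun y => g y μ ν) x)

/-- Riemann tensor `R^ρ_{σμν}`. -/
def riemann (g : MetricField) (ρ σ μ ν : Fin 4) (x : Coord) : ℝ :=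
  pd μ (christoffel g ρ ν σ) x - pd ν (christoffel g ρ μ σ) x
    + ∑ κ, (christoffel g ρ μ κ x * christoffel g κ ν σ x
      - christoffel g ρ ν κ x * christoffel g κ μ σ x)

/-- Ricci tensor `R_{μν} = R^ρ_{μρν}`. -/
def ricci (g : MetricField) (μ ν : Fin 4) (x : Coord) : ℝ := ∑ ρ, riemann g ρ μ ρ ν x

/-- Ricci tensor with its first index raised, `R^μ_ν = g^{μκ} R_{κν}`. -/
def ricciMixed (g : MetricField) (μ ν : Fin 4) (x : Coord) : ℝ :=
  ∑ κ, (g x)⁻¹ μ κ * ricci g κ ν x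

/-- Scalar curvature `R = R^μ_μ`. -/
def scalarCurvature (g : MetricField) (x : Coord) : ℝ := ∑ μ, ricciMixed g μ μ x

/-- The `1`-`1` Einstein tensor `G^μ_ν = R^μ_ν - (1/2) R δ^μ_ν`. -/
def einstein (g : MetricField) (μ ν : Fin 4) (x : Coord) : ℝ :=
  ricciMixed g μ ν x - (1 / 2) * scalarCurvature g x * (1 : Matrix (Fin 4) (Fin 4) ℝ) μ ν

/-- Covariant derivative `∇_μ ψ^ν` of a vector field. -/
def covDeriv (g : MetricField) (ψ : Coord → Coord) (μ ν : Fin 4) (x : Coord) : ℝ :=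
  pd μ (fun y => ψ y ν) x + ∑ κ, christoffel g ν μ κ x * ψ x κ

/-- Density of the metric volume: `d vol_g = √|det g| dx⁰ dx¹ dx² dx³`. -/
def volDensity (g : MetricField) (x : Coord) : ℝ := Real.sqrt |(g x).det|

/-- The line element
`-e^{2α(r)} c² dt² + e^{2β(r)} dr² + r² (dθ² + sin² θ dφ²)` in the coordinates `(t, r, θ, φ)`. -/
def sphericalMetric (c : ℝ) (α β : ℝ → ℝ) : MetricField := fun y =>
  Matrix.diagonal ![-(c ^ 2 * Real.exp (2 * α (y 1))), Real.exp (2 * β (y 1)),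
    (y 1) ^ 2, (y 1) ^ 2 * Real.sin (y 2) ^ 2]

/-- Euclidean distance of `(t, x¹, x², x³)` from the time axis. -/
def radius (x : Coord) : ℝ := Real.sqrt (x 1 ^ 2 + x 2 ^ 2 + x 3 ^ 2)

/-- Components of the one-form `dr = (x¹ dx¹ + x² dx² + x³ dx³) / r` in Cartesian coordinates. -/
def radialForm (x : Coord) : Coord :=
  ![0, x 1 / radius x, x 2 / radius x, x 3 / radius x]

/-- The same line element in the Cartesian coordinates `(t, x¹, x², x³)`. Since
`r² (dθ² + sin² θ dφ²) = |dx|² - dr²`, it is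
`-e^{2α(r)} c² dt² + |dx|² + (e^{2β(r)} - 1) dr²`. Only its values at `r > 0` matter. -/
def cartesianMetric (c : ℝ) (α β : ℝ → ℝ) : MetricField := fun x =>
  Matrix.diagonal ![-(c ^ 2 * Real.exp (2 * α (radius x))), 1, 1, 1]
    + (Real.exp (2 * β (radius x)) - 1) • Matrix.vecMulVec (radialForm x) (radialForm x)

/-- The component `G^μ_ν` in the spherical coordinates `(t, r, θ, φ)`, as a function of `r`.
The diagonal components of the metrics above depend on `r` alone, so they are read off at
`t = 0`, `θ = π / 2`, `φ = 0`. -/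
def sphericalEinstein (c : ℝ) (α β : ℝ → ℝ) (μ ν : Fin 4) (r : ℝ) : ℝ :=
  einstein (sphericalMetric c α β) μ ν ![0, r, Real.pi / 2, 0]

/-- The scalar `G^μ_ν ∇_μ ψ^ν` times the volume density, in Cartesian coordinates. -/
def bianchiIntegrand (c : ℝ) (α β : ℝ → ℝ) (ψ : Coord → Coord) (x : Coord) : ℝ :=
  (∑ μ, ∑ ν, einstein (cartesianMetric c α β) μ ν x * covDeriv (cartesianMetric c α β) ψ μ ν x)
    * volDensity (cartesianMetric c α β) x

/-- The complement `Ω_ε` in `ℝ⁴` of the cylinder of radius `ε` around the time axis. -/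
def outerRegion (ε : ℝ) : Set Coord := {x | ε ≤ radius x}

/-- The twice-contracted second Bianchi identity holds weakly on `ℝ⁴`: for every test vector
field `ψ`, `∫ G^μ_ν ∇_μ ψ^ν d vol_g = 0`. The integrand is defined off the time axis, where it
may be singular, and the integral is the limit as `ε ↓ 0` of the (absolutely convergent)
integrals over `Ω_ε`; where it exists as a Lebesgue integral over `ℝ⁴`, it vanishes as such. -/
def WeakBianchi (c : ℝ) (α β : ℝ → ℝ) : Prop :=
  ∀ ψ : Coord → Coord, ContDiff ℝ (⊤ : ℕ∞) ψ → HasCompactSupport ψ →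
    (∀ ε > 0, IntegrableOn (bianchiIntegrand c α β ψ) (outerRegion ε)) ∧
    Tendsto (fun ε => ∫ x in outerRegion ε, bianchiIntegrand c α β ψ x) (𝓝[>] 0) (𝓝 0) ∧
    (Integrable (bianchiIntegrand c α β ψ) → ∫ x, bianchiIntegrand c α β ψ x = 0)

/-- `r³ (|G^t_t| + |G^r_r| + |G^θ_θ|) e^{α+β} = O(r^γ)` as `r ↓ 0`. -/
def EinsteinDecay (c : ℝ) (α β : ℝ → ℝ) (γ : ℝ) : Prop :=
  (fun r : ℝ => r ^ 3 * (|sphericalEinstein c α β 0 0 r| + |sphericalEinstein c α β 1 1 r|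
    + |sphericalEinstein c α β 2 2 r|) * Real.exp (α r + β r)) =O[𝓝[>] 0] (fun r : ℝ => r ^ γ)

/-- `ε³ G^r_r(ε) ‖e^{α+β}‖_{L^∞((0,ε])} → 0` as `ε ↓ 0`, stated for absolute values because the
norm is an extended real (with `0 · ∞ = 0`). -/
def RadialLimit (c : ℝ) (α β : ℝ → ℝ) : Prop :=
  Tendsto (fun ε : ℝ => ENNReal.ofReal |ε ^ 3 * sphericalEinstein c α β 1 1 ε| *
    eLpNorm (fun r => Real.exp (α r + β r)) ⊤ (volume.restrict (Ioc 0 ε))) (𝓝[>] 0) (𝓝 0)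

/-- `r e^{α-β} (1 - e^{2β} - 2 r β') = O(r^γ)` as `r ↓ 0`. -/
def DecayTT (α β : ℝ → ℝ) (γ : ℝ) : Prop :=
  (fun r : ℝ => r * Real.exp (α r - β r) * (1 - Real.exp (2 * β r) - 2 * r * deriv β r))
    =O[𝓝[>] 0] (fun r : ℝ => r ^ γ)

/-- `r e^{α-β} (1 - e^{2β} + 2 r α') = O(r^γ)` as `r ↓ 0`. -/
def DecayRR (α β : ℝ → ℝ) (γ : ℝ) : Prop :=
  (fun r : ℝ => r * Real.exp (α r - β r) * (1 - Real.exp (2 * β r) + 2 * r * deriv α r))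
    =O[𝓝[>] 0] (fun r : ℝ => r ^ γ)

/-- `r² e^{α-β} [(1 + r α') (α' - β') + r α''] = O(r^γ)` as `r ↓ 0`. -/
def DecayThetaTheta (α β : ℝ → ℝ) (γ : ℝ) : Prop :=
  (fun r : ℝ => r ^ 2 * Real.exp (α r - β r) *
    ((1 + r * deriv α r) * (deriv α r - deriv β r) + r * deriv (deriv α) r))
    =O[𝓝[>] 0] (fun r : ℝ => r ^ γ)

end StaticBianchi

end

/-!
Off the axis, the contracted Bianchi identity makes `G^μ_ν ∇_μ ψ^ν`, multiplied by the volume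
density, the Euclidean divergence of the flux `c e^{α+β} G^μ_ν ψ^ν`. Integrated over `{|x| ≥ ε}`,
only the boundary term on the cylinder `|x| = ε` survives. There the radial vector is an
eigenvector of `G` with eigenvalue `G^r_r`, so the boundary flux density is
`c e^{α+β} G^r_r (x · ψ) / |x|`. Pairing `(t, x)` with `(t, -x)` cancels the value of `ψ` on the
axis and makes `x · ψ` quadratically small; since the cylinder has area of order `ε²`, the boundary
term is of order `ε³ e^{α+β} G^r_r`, which tends to `0`.
-/

noncomputable section

namespace StaticBianchi

/-! ### Static, spherically symmetric tensors in Cartesian coordinates -/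

/-- The components `δ^i_μ` of the differential `dx^i` of a coordinate. -/
def dx (i μ : Fin 4) : ℝ := if μ = i then 1 else 0

/-- `f` is differentiable at `x` with partial derivatives `∂_μ f = v μ`. Coordinate calculations
are done with this predicate because, unlike `pd`, it composes without side goals. -/
def HasPartials (f : Coord → ℝ) (v : Fin 4 → ℝ) (x : Coord) : Prop :=
  DifferentiableAt ℝ f x ∧ ∀ μ, pd μ f x = v μ

namespace HasPartials

variable {f g : Coord → ℝ} {v w : Fin 4 → ℝ} {x : Coord}

theorem of_differentiableAt (hf : DifferentiableAt ℝ f x) : HasPartials f (fun μ => pd μ f x) x :=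
  ⟨hf, fun _ => rfl⟩

theorem const (a : ℝ) (x : Coord) : HasPartials (fun _ => a) (fun _ => 0) x :=
  ⟨differentiableAt_const a, fun μ => by simp [pd]⟩

theorem coord (i : Fin 4) (x : Coord) :
    HasPartials (fun y => y i) (dx i) x := by
  have h := hasFDerivAt_apply (𝕜 := ℝ) i x
  exact ⟨h.differentiableAt, fun μ => by simp [pd, dx, h.fderiv, Pi.single_apply, eq_comm]⟩

theorem add (hf : HasPartials f v x) (hg : HasPartials g w x) :
    HasPartials (fun y => f y + g y) (fun μ => v μ + w μ) x :=
  ⟨hf.1.add hg.1, fun μ => by simp only [← hf.2, ← hg.2, pd, fderiv_fun_add hf.1 hg.1,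
    add_apply]⟩

theorem mul (hf : HasPartials f v x) (hg : HasPartials g w x) :
    HasPartials (fun y => f y * g y) (fun μ => v μ * g x + f x * w μ) x :=
  ⟨hf.1.mul hg.1, fun μ => by
    simp only [← hf.2, ← hg.2, pd, fderiv_fun_mul hf.1 hg.1, add_apply,
      smul_apply, smul_eq_mul]
    ring⟩

theorem comp {h : ℝ → ℝ} {h' : ℝ} (hh : HasDerivAt h h' (f x)) (hf : HasPartials f v x) :
    HasPartials (fun y => h (f y)) (fun μ => h' * v μ) x := by
  have hcomp : HasFDerivAt (fun y => h (f y)) (h' • fderiv ℝ f x) x :=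
    hh.comp_hasFDerivAt x hf.1.hasFDerivAt
  exact ⟨hcomp.differentiableAt, fun μ => by
    simp only [← hf.2, pd, hcomp.fderiv, smul_apply, smul_eq_mul]⟩

theorem congr (hf : HasPartials f v x) (h : g =ᶠ[𝓝 x] f) (hv : ∀ μ, v μ = w μ) :
    HasPartials g w x :=
  ⟨hf.1.congr_of_eventuallyEq h, fun μ => by rw [← hv, ← hf.2, pd, h.fderiv_eq, pd]⟩

theorem congr_partials (hf : HasPartials f v x) (hv : ∀ μ, v μ = w μ) : HasPartials f w x :=
  hf.congr .rfl hv

theorem sum {ι : Type*} {s : Finset ι} {f : ι → Coord → ℝ} {v : ι → Fin 4 → ℝ}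
    (h : ∀ i ∈ s, HasPartials (f i) (v i) x) :
    HasPartials (fun y => ∑ i ∈ s, f i y) (fun μ => ∑ i ∈ s, v i μ) x :=
  ⟨.fun_sum fun i hi => (h i hi).1, fun μ => by
    rw [pd, fderiv_fun_sum fun i hi => (h i hi).1, sum_apply]
    exact Finset.sum_congr rfl fun i hi => (h i hi).2 μ⟩

end HasPartials

theorem continuous_radius : Continuous radius := by
  unfold radius; fun_prop

theorem radius_nonneg (x : Coord) : 0 ≤ radius x := Real.sqrt_nonneg _

theorem radius_sq (x : Coord) : radius x ^ 2 = x 1 ^ 2 + x 2 ^ 2 + x 3 ^ 2 :=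
  Real.sq_sqrt (by positivity)

/-- The complement of the time axis, on which the Cartesian form of the metric is regular. -/
def offAxis : Set Coord := {x | 0 < radius x}

theorem isOpen_offAxis : IsOpen offAxis := isOpen_lt continuous_const continuous_radius

/-- The spatial part `(0, x¹, x², x³)` of a point. -/
def spatial (x : Coord) : Coord := ![0, x 1, x 2, x 3]

/-- The Kronecker symbol `δ_{ij}` of the spatial indices, extended by zero to the time index. -/
def spaceDelta (μ ν : Fin 4) : ℝ := if μ = ν ∧ μ ≠ 0 then 1 else 0

theorem spaceDelta_comm (μ ν : Fin 4) : spaceDelta μ ν = spaceDelta ν μ := by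
  unfold spaceDelta; grind

theorem spaceDelta_self (μ : Fin 4) : spaceDelta μ μ = 1 - dx 0 μ := by
  fin_cases μ <;> simp [spaceDelta, dx]

theorem sum_spatial_mul_spatial (x : Coord) : ∑ σ, spatial x σ * spatial x σ = radius x ^ 2 := by
  simp only [Fin.sum_univ_four, spatial, radius_sq, Matrix.cons_val]; ring

theorem sum_spatial_mul_dx_zero (x : Coord) : ∑ σ, spatial x σ * dx 0 σ = 0 := by
  simp [spatial, dx]

theorem sum_dx_zero_mul_dx_zero : ∑ σ, dx 0 σ * dx 0 σ = 1 := by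
  simp [dx]

theorem sum_spaceDelta_mul_spatial (x : Coord) (ρ : Fin 4) :
    ∑ σ, spaceDelta ρ σ * spatial x σ = spatial x ρ := by
  fin_cases ρ <;> simp [spaceDelta, spatial]

theorem sum_spaceDelta_mul_dx_zero (ρ : Fin 4) : ∑ σ, spaceDelta ρ σ * dx 0 σ = 0 := by
  fin_cases ρ <;> simp [spaceDelta, dx]

theorem hasPartials_spatial (i : Fin 4) (x : Coord) :
    HasPartials (fun y => spatial y i) (fun μ => spaceDelta μ i) x := by
  cases i using Fin.cases with
  | zero => exact (HasPartials.const 0 x).congr_partials fun μ => by simp [spaceDelta]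
  | succ j =>
    refine (HasPartials.coord j.succ x).congr (.of_forall fun y => ?_) fun μ => ?_
    · fin_cases j <;> rfl
    · unfold dx spaceDelta; grind

theorem hasPartials_radius {x : Coord} (hx : 0 < radius x) :
    HasPartials radius (fun μ => spatial x μ / radius x) x := by
  have hsq : HasPartials (fun y => y 1 ^ 2 + y 2 ^ 2 + y 3 ^ 2) (fun μ => 2 * spatial x μ) x := by
    refine (HasPartials.sum fun σ (_ : σ ∈ Finset.univ) =>
      (hasPartials_spatial σ x).mul (hasPartials_spatial σ x)).congr
        (.of_forall fun y => ?_) fun μ => ?_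
    · beta_reduce
      rw [sum_spatial_mul_spatial, radius_sq]
    · simp only [mul_comm (spatial x _), ← two_mul, ← Finset.mul_sum, sum_spaceDelta_mul_spatial]
  have hsqrt := Real.hasDerivAt_sqrt (by rw [← radius_sq]; positivity :
    x 1 ^ 2 + x 2 ^ 2 + x 3 ^ 2 ≠ 0)
  refine (HasPartials.comp hsqrt hsq).congr_partials fun μ => ?_
  rw [show √(x 1 ^ 2 + x 2 ^ 2 + x 3 ^ 2) = radius x from rfl]
  field_simp

theorem hasPartials_radial {h : ℝ → ℝ} {h' : ℝ} {x : Coord} (hx : 0 < radius x)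
    (hh : HasDerivAt h h' (radius x)) :
    HasPartials (fun y => h (radius y)) (fun μ => h' / radius x * spatial x μ) x :=
  (HasPartials.comp hh (hasPartials_radius hx)).congr_partials fun μ => by ring

/-- The static, spherically symmetric tensor `a dt² + b |dx|² + p (x · dx)²`, that is,
`a δ^t_μ δ^t_ν + b δ_{ij} + p x_i x_j`, at the point `x`. -/
def frameTensor (a b p : ℝ) (x : Coord) (μ ν : Fin 4) : ℝ :=
  a * (dx 0 μ * dx 0 ν) + b * spaceDelta μ ν + p * (spatial x μ * spatial x ν)

theorem sum_frameTensor_mul_dx_zero (a b p : ℝ) (x : Coord) (μ : Fin 4) :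
    ∑ κ, frameTensor a b p x μ κ * dx 0 κ = a * dx 0 μ := by
  simp only [frameTensor, add_mul, mul_assoc, Finset.sum_add_distrib, ← Finset.mul_sum,
    sum_dx_zero_mul_dx_zero, sum_spaceDelta_mul_dx_zero, sum_spatial_mul_dx_zero]
  ring

theorem sum_frameTensor_mul_spatial (a b p : ℝ) (x : Coord) (μ : Fin 4) :
    ∑ κ, frameTensor a b p x μ κ * spatial x κ = (b + p * radius x ^ 2) * spatial x μ := by
  have hts : ∑ κ, dx 0 κ * spatial x κ = 0 := by
    simpa only [mul_comm] using sum_spatial_mul_dx_zero x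
  simp only [frameTensor, add_mul, mul_assoc, Finset.sum_add_distrib, ← Finset.mul_sum,
    hts, sum_spaceDelta_mul_spatial, sum_spatial_mul_spatial]
  ring

theorem sum_frameTensor_mul_spaceDelta (a b p : ℝ) (x : Coord) (μ ν : Fin 4) :
    ∑ κ, frameTensor a b p x μ κ * spaceDelta κ ν = frameTensor 0 b p x μ ν := by
  cases ν using Fin.cases with
  | zero => simp [spaceDelta, frameTensor, dx, spatial]
  | succ j =>
    simp only [spaceDelta]
    rw [Finset.sum_eq_single j.succ (by grind) (by simp)]
    fin_cases j <;> simp [frameTensor, dx]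

theorem sum_frameTensor_mul (a b p a' b' p' : ℝ) (x : Coord) (μ ν : Fin 4) :
    ∑ κ, frameTensor a b p x μ κ * frameTensor a' b' p' x κ ν =
      frameTensor (a * a') (b * b') (b * p' + p * b' + p * p' * radius x ^ 2) x μ ν := by
  have hdist : ∀ κ, frameTensor a b p x μ κ * frameTensor a' b' p' x κ ν =
      frameTensor a b p x μ κ * dx 0 κ * (a' * dx 0 ν)
        + b' * (frameTensor a b p x μ κ * spaceDelta κ ν)
        + frameTensor a b p x μ κ * spatial x κ * (p' * spatial x ν) := fun κ => by
    rw [frameTensor.eq_def a' b' p']; ring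
  simp only [hdist, Finset.sum_add_distrib, ← Finset.mul_sum, ← Finset.sum_mul,
    sum_frameTensor_mul_dx_zero, sum_frameTensor_mul_spaceDelta, sum_frameTensor_mul_spatial]
  unfold frameTensor
  ring

theorem sum_frameTensor_self (a b p : ℝ) (x : Coord) :
    ∑ μ, frameTensor a b p x μ μ = a + 3 * b + p * radius x ^ 2 := by
  simp only [frameTensor, Finset.sum_add_distrib, ← Finset.mul_sum, sum_dx_zero_mul_dx_zero,
    sum_spatial_mul_spatial, spaceDelta_self, Finset.sum_sub_distrib]
  simp only [dx, mul_one, Finset.sum_const, Finset.card_univ, Fintype.card_fin, nsmul_eq_mul,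
    Nat.cast_ofNat, Finset.sum_ite_eq', Finset.mem_univ, if_true]
  ring

theorem one_eq_frameTensor (x : Coord) (μ ν : Fin 4) :
    (1 : Matrix (Fin 4) (Fin 4) ℝ) μ ν = frameTensor 1 1 0 x μ ν := by
  fin_cases μ <;> fin_cases ν <;> simp [frameTensor, dx, spaceDelta]

/-! ### The Ricci tensor of a radial connection -/

theorem ricci_eq_contractions {g : MetricField} {x : Coord} {μ : Fin 4}
    (h : ∀ ρ, DifferentiableAt ℝ (christoffel g ρ ρ μ) x) (ν : Fin 4) :
    ricci g μ ν x = ∑ ρ, pd ρ (christoffel g ρ ν μ) x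
      - pd ν (fun y => ∑ ρ, christoffel g ρ ρ μ y) x
      + ∑ κ, (∑ ρ, christoffel g ρ ρ κ x) * christoffel g κ ν μ x
      - ∑ κ, ∑ ρ, christoffel g ρ ν κ x * christoffel g κ ρ μ x := by
  have htrace := (HasPartials.sum fun ρ (_ : ρ ∈ Finset.univ) => .of_differentiableAt (h ρ)).2 ν
  simp only [ricci, riemann, htrace, Finset.sum_add_distrib, Finset.sum_sub_distrib,
    Finset.sum_mul]
  rw [Finset.sum_comm, Finset.sum_comm (f := fun ρ κ => christoffel g ρ ν κ x * _)]
  ring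

theorem frameTensor_comm (a b p : ℝ) (x : Coord) (μ ν : Fin 4) :
    frameTensor a b p x μ ν = frameTensor a b p x ν μ := by
  simp only [frameTensor, spaceDelta_comm μ ν]
  ring

theorem sum_spaceDelta_self : ∑ μ, spaceDelta μ μ = 3 := by
  simp only [spaceDelta_self, Finset.sum_sub_distrib, dx, Finset.sum_ite_eq', Finset.mem_univ,
    if_true, Finset.sum_const, Finset.card_univ, Fintype.card_fin]
  norm_num

section RadialCoefficients

variable {a b p : ℝ → ℝ} {a' b' p' : ℝ} {x : Coord}

theorem hasPartials_frameTensor (hx : 0 < radius x) (ha : HasDerivAt a a' (radius x))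
    (hb : HasDerivAt b b' (radius x)) (hp : HasDerivAt p p' (radius x)) (μ ν : Fin 4) :
    HasPartials (fun y => frameTensor (a (radius y)) (b (radius y)) (p (radius y)) y μ ν)
      (fun κ => frameTensor (a' / radius x) (b' / radius x) (p' / radius x) x μ ν * spatial x κ
        + p (radius x) * (spaceDelta κ μ * spatial x ν + spatial x μ * spaceDelta κ ν)) x := by
  have hxx := (hasPartials_spatial μ x).mul (hasPartials_spatial ν x)
  refine ((((hasPartials_radial hx ha).mul (.const (dx 0 μ * dx 0 ν) x)).add
    ((hasPartials_radial hx hb).mul (.const (spaceDelta μ ν) x))).add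
      ((hasPartials_radial hx hp).mul hxx)).congr_partials fun κ => ?_
  unfold frameTensor
  ring

theorem sum_pd_frameTensor (hx : 0 < radius x) (ha : HasDerivAt a a' (radius x))
    (hb : HasDerivAt b b' (radius x)) (hp : HasDerivAt p p' (radius x)) (ν : Fin 4) :
    ∑ μ, pd μ (fun y => frameTensor (a (radius y)) (b (radius y)) (p (radius y)) y μ ν) x =
      (b' / radius x + p' * radius x + 4 * p (radius x)) * spatial x ν := by
  simp only [(hasPartials_frameTensor hx ha hb hp _ ν).2, mul_add, Finset.sum_add_distrib,
    frameTensor_comm _ _ _ x _ ν, sum_frameTensor_mul_spatial, ← mul_assoc, mul_right_comm,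
    ← Finset.mul_sum, ← Finset.sum_mul, sum_spaceDelta_self]
  simp only [mul_assoc, spaceDelta_comm _ ν, ← Finset.mul_sum, sum_spaceDelta_mul_spatial]
  field_simp
  ring

end RadialCoefficients

/-- The connection coefficients
`Γ^ρ_{μν} = x^ρ (P δ_{ij} + Q x_i x_j + V δ^t_μ δ^t_ν) + U δ^ρ_t (δ^t_μ x_ν + x_μ δ^t_ν)`, with
`P`, `Q`, `U`, `V` functions of the radius: the form taken in Cartesian coordinates by the
Levi-Civita connection of a static, spherically symmetric metric. -/
def radialConnection (P Q U V : ℝ → ℝ) (ρ μ ν : Fin 4) (x : Coord) : ℝ :=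
  spatial x ρ * frameTensor (V (radius x)) (P (radius x)) (Q (radius x)) x μ ν
    + dx 0 ρ * (U (radius x) * (dx 0 μ * spatial x ν + spatial x μ * dx 0 ν))

section RadialConnection

variable {P Q U V : ℝ → ℝ} {P' Q' U' V' : ℝ} {x : Coord}

theorem hasPartials_radialConnection (hx : 0 < radius x) (hP : HasDerivAt P P' (radius x))
    (hQ : HasDerivAt Q Q' (radius x)) (hU : HasDerivAt U U' (radius x))
    (hV : HasDerivAt V V' (radius x)) (ρ μ ν : Fin 4) :
    HasPartials (radialConnection P Q U V ρ μ ν) (fun κ =>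
      spaceDelta κ ρ * frameTensor (V (radius x)) (P (radius x)) (Q (radius x)) x μ ν
      + spatial x ρ * (frameTensor (V' / radius x) (P' / radius x) (Q' / radius x) x μ ν
          * spatial x κ
        + Q (radius x) * (spaceDelta κ μ * spatial x ν + spatial x μ * spaceDelta κ ν))
      + dx 0 ρ * (U' / radius x * spatial x κ
          * (dx 0 μ * spatial x ν + spatial x μ * dx 0 ν)
        + U (radius x) * (dx 0 μ * spaceDelta κ ν + spaceDelta κ μ * dx 0 ν))) x := by
  have s := fun i => hasPartials_spatial i x
  have k := fun a => HasPartials.const a x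
  exact (((s ρ).mul (hasPartials_frameTensor hx hV hP hQ μ ν)).add
    ((k (dx 0 ρ)).mul ((hasPartials_radial hx hU).mul
      (((k (dx 0 μ)).mul (s ν)).add ((s μ).mul (k (dx 0 ν))))))).congr_partials
    fun κ => by ring

theorem sum_radialConnection_trace (x : Coord) (μ : Fin 4) :
    ∑ ρ, radialConnection P Q U V ρ ρ μ x =
      (P (radius x) + Q (radius x) * radius x ^ 2 + U (radius x)) * spatial x μ := by
  have hterm : ∀ ρ, radialConnection P Q U V ρ ρ μ x =
      frameTensor (V (radius x)) (P (radius x)) (Q (radius x)) x μ ρ * spatial x ρ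
      + U (radius x) * spatial x μ * (dx 0 ρ * dx 0 ρ)
      + U (radius x) * dx 0 μ * (spatial x ρ * dx 0 ρ) := fun ρ => by
    rw [radialConnection, frameTensor_comm]; ring
  simp only [hterm, Finset.sum_add_distrib, ← Finset.mul_sum, sum_frameTensor_mul_spatial,
    sum_dx_zero_mul_dx_zero, sum_spatial_mul_dx_zero]
  ring

theorem sum_spatial_mul_radialConnection (x : Coord) (μ ν : Fin 4) :
    ∑ κ, spatial x κ * radialConnection P Q U V κ μ ν x =
      radius x ^ 2 * frameTensor (V (radius x)) (P (radius x)) (Q (radius x)) x μ ν := by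
  simp only [radialConnection, mul_add, ← mul_assoc, Finset.sum_add_distrib, ← Finset.sum_mul,
    sum_spatial_mul_spatial, sum_spatial_mul_dx_zero]
  ring

theorem sum_pd_radialConnection (hx : 0 < radius x) (hP : HasDerivAt P P' (radius x))
    (hQ : HasDerivAt Q Q' (radius x)) (hU : HasDerivAt U U' (radius x))
    (hV : HasDerivAt V V' (radius x)) (μ ν : Fin 4) :
    ∑ ρ, pd ρ (radialConnection P Q U V ρ μ ν) x =
      frameTensor (3 * V (radius x) + radius x * V') (3 * P (radius x) + radius x * P')
        (5 * Q (radius x) + radius x * Q') x μ ν := by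
  set r := radius x
  have hterm : ∀ ρ, pd ρ (radialConnection P Q U V ρ μ ν) x =
      frameTensor (V r) (P r) (Q r) x μ ν * spaceDelta ρ ρ
      + frameTensor (V' / r) (P' / r) (Q' / r) x μ ν * (spatial x ρ * spatial x ρ)
      + Q r * spatial x ν * (spaceDelta μ ρ * spatial x ρ)
      + Q r * spatial x μ * (spaceDelta ν ρ * spatial x ρ)
      + U' / r * (dx 0 μ * spatial x ν + spatial x μ * dx 0 ν)
        * (spatial x ρ * dx 0 ρ)
      + U r * dx 0 μ * (spaceDelta ν ρ * dx 0 ρ)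
      + U r * dx 0 ν * (spaceDelta μ ρ * dx 0 ρ) := fun ρ => by
    rw [(hasPartials_radialConnection hx hP hQ hU hV ρ μ ν).2, spaceDelta_comm μ,
      spaceDelta_comm ν]
    ring
  simp only [hterm, Finset.sum_add_distrib, ← Finset.mul_sum, sum_spaceDelta_self,
    sum_spatial_mul_spatial, sum_spaceDelta_mul_spatial, sum_spatial_mul_dx_zero,
    sum_spaceDelta_mul_dx_zero]
  unfold frameTensor
  field_simp
  ring

theorem sum_radialConnection_mul_radialConnection (x : Coord) (μ ν : Fin 4) :
    ∑ κ, ∑ ρ, radialConnection P Q U V ρ ν κ x * radialConnection P Q U V κ ρ μ x =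
      frameTensor (2 * U (radius x) * V (radius x) * radius x ^ 2) 0
        ((P (radius x) + Q (radius x) * radius x ^ 2) ^ 2 + U (radius x) ^ 2) x μ ν := by
  set r := radius x
  let S := frameTensor (V r) (P r) (Q r) x
  have hτx : ∑ κ, dx 0 κ * spatial x κ = 0 := by
    simpa only [mul_comm] using sum_spatial_mul_dx_zero x
  have hinner : ∀ κ, ∑ ρ, radialConnection P Q U V ρ ν κ x * radialConnection P Q U V κ ρ μ x =
      (P r + Q r * r ^ 2) * spatial x μ * (S ν κ * spatial x κ)
      + U r * r ^ 2 * dx 0 μ * (S ν κ * dx 0 κ)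
      + U r * V r * dx 0 μ * dx 0 ν * (spatial x κ * spatial x κ)
      + U r ^ 2 * spatial x μ * dx 0 ν * (dx 0 κ * spatial x κ)
      + U r * V r * dx 0 μ * spatial x ν * (spatial x κ * dx 0 κ)
      + U r ^ 2 * spatial x μ * spatial x ν * (dx 0 κ * dx 0 κ) := fun κ => by
    have hterm : ∀ ρ, radialConnection P Q U V ρ ν κ x * radialConnection P Q U V κ ρ μ x =
        S ν κ * spatial x κ * (S μ ρ * spatial x ρ)
        + S ν κ * dx 0 κ * U r * spatial x μ * (spatial x ρ * dx 0 ρ)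
        + S ν κ * dx 0 κ * U r * dx 0 μ * (spatial x ρ * spatial x ρ)
        + U r * (dx 0 ν * spatial x κ + spatial x ν * dx 0 κ)
          * (spatial x κ * (S μ ρ * dx 0 ρ)
            + U r * dx 0 κ * spatial x μ * (dx 0 ρ * dx 0 ρ)
            + U r * dx 0 κ * dx 0 μ * (spatial x ρ * dx 0 ρ)) := fun ρ => by
      rw [radialConnection, radialConnection, frameTensor_comm _ _ _ x ρ μ]; ring
    simp only [hterm, Finset.sum_add_distrib, ← Finset.mul_sum, S, sum_frameTensor_mul_spatial,
      sum_frameTensor_mul_dx_zero, sum_spatial_mul_spatial, sum_spatial_mul_dx_zero,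
      sum_dx_zero_mul_dx_zero]
    ring
  simp only [hinner, Finset.sum_add_distrib, ← Finset.mul_sum, S, sum_frameTensor_mul_spatial,
    sum_frameTensor_mul_dx_zero, sum_spatial_mul_spatial, sum_spatial_mul_dx_zero, hτx,
    sum_dx_zero_mul_dx_zero]
  unfold frameTensor
  ring

theorem ricci_eq_of_radialConnection {g : MetricField} (hx : 0 < radius x)
    (hg : ∀ y, 0 < radius y → ∀ ρ μ ν, christoffel g ρ μ ν y = radialConnection P Q U V ρ μ ν y)
    (hP : HasDerivAt P P' (radius x)) (hQ : HasDerivAt Q Q' (radius x))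
    (hU : HasDerivAt U U' (radius x)) (hV : HasDerivAt V V' (radius x)) (μ ν : Fin 4) :
    ricci g μ ν x = frameTensor
      (3 * V (radius x) + radius x * V'
        + (P (radius x) + Q (radius x) * radius x ^ 2 - U (radius x)) * radius x ^ 2 * V (radius x))
      (2 * P (radius x) + radius x * P' - Q (radius x) * radius x ^ 2 - U (radius x)
        + (P (radius x) + Q (radius x) * radius x ^ 2 + U (radius x)) * radius x ^ 2 * P (radius x))
      (3 * Q (radius x) - P' / radius x - U' / radius x
        + (P (radius x) + Q (radius x) * radius x ^ 2 + U (radius x)) * radius x ^ 2 * Q (radius x)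
        - (P (radius x) + Q (radius x) * radius x ^ 2) ^ 2 - U (radius x) ^ 2) x μ ν := by
  have hev : ∀ ρ μ ν, christoffel g ρ μ ν =ᶠ[𝓝 x] radialConnection P Q U V ρ μ ν := fun ρ μ ν =>
    mem_of_superset (isOpen_offAxis.mem_nhds hx) fun y hy => hg y hy ρ μ ν
  have hΓ : ∀ ρ μ ν, HasPartials (christoffel g ρ μ ν) _ x := fun ρ μ ν =>
    (hasPartials_radialConnection hx hP hQ hU hV ρ μ ν).congr (hev ρ μ ν) fun _ => rfl
  have hdiv : ∑ ρ, pd ρ (christoffel g ρ ν μ) x = _ := (Finset.sum_congr rfl fun ρ _ => by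
    rw [pd, (hev ρ ν μ).fderiv_eq, ← pd]).trans (sum_pd_radialConnection hx hP hQ hU hV ν μ)
  have htrace : (fun y => ∑ ρ, christoffel g ρ ρ μ y) =ᶠ[𝓝 x]
      fun y => (P (radius y) + Q (radius y) * radius y ^ 2 + U (radius y)) * spatial y μ := by
    filter_upwards [isOpen_offAxis.mem_nhds hx] with y hy
    simp only [hg y hy, sum_radialConnection_trace]
  have hT : HasDerivAt (fun r => P r + Q r * r ^ 2 + U r) _ (radius x) :=
    (hP.add (hQ.mul (hasDerivAt_pow 2 (radius x)))).add hU
  have hpd := (((hasPartials_radial hx hT).mul (hasPartials_spatial μ x)).congr htrace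
    fun _ => rfl).2 ν
  rw [ricci_eq_contractions fun ρ => (hΓ ρ ρ μ).1, hdiv, hpd]
  simp only [hg x hx, sum_radialConnection_trace, mul_assoc, ← Finset.mul_sum,
    sum_spatial_mul_radialConnection, sum_radialConnection_mul_radialConnection]
  simp only [frameTensor, spaceDelta_comm ν μ]
  field_simp
  push_cast
  ring

end RadialConnection

/-! ### The Einstein tensor in Cartesian coordinates -/

section FrameMetric

variable {g : MetricField} {a p : ℝ → ℝ} {a' p' : ℝ} {x : Coord}

theorem inv_frameTensor_apply {m : Matrix (Fin 4) (Fin 4) ℝ} {a p : ℝ}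
    (hm : ∀ μ ν, m μ ν = frameTensor a 1 p x μ ν) (ha : a ≠ 0) (hp : 1 + p * radius x ^ 2 ≠ 0)
    (μ ν : Fin 4) :
    m⁻¹ μ ν = frameTensor a⁻¹ 1 (-(p / (1 + p * radius x ^ 2))) x μ ν := by
  suffices m⁻¹ = Matrix.of (frameTensor a⁻¹ 1 (-(p / (1 + p * radius x ^ 2))) x) by
    rw [this, Matrix.of_apply]
  refine Matrix.inv_eq_right_inv (Matrix.ext fun μ ν => ?_)
  simp only [Matrix.mul_apply, hm, Matrix.of_apply, sum_frameTensor_mul, one_eq_frameTensor x]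
  congr 1
  · exact mul_inv_cancel₀ ha
  · norm_num
  · field_simp
    ring

theorem det_frameTensor (a p : ℝ) (x : Coord) :
    (Matrix.of (frameTensor a 1 p x)).det = a * (1 + p * radius x ^ 2) := by
  have hfactor : Matrix.of (frameTensor a 1 p x) = Matrix.diagonal ![a, 1, 1, 1] *
      (1 + Matrix.replicateCol Unit (p • spatial x) * Matrix.replicateRow Unit (spatial x)) := by
    ext μ ν
    rw [Matrix.of_apply, Matrix.diagonal_mul, Matrix.add_apply, Matrix.mul_apply]
    fin_cases μ <;> fin_cases ν <;>
      simp [frameTensor, dx, spaceDelta, spatial, mul_assoc]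
  rw [hfactor, Matrix.det_mul, Matrix.det_diagonal,
    Matrix.det_one_add_replicateCol_mul_replicateRow, dotProduct_smul, dotProduct,
    sum_spatial_mul_spatial, Fin.prod_univ_four]
  simp

theorem christoffel_eq_of_frameTensor
    (hg : ∀ y μ ν, g y μ ν = frameTensor (a (radius y)) 1 (p (radius y)) y μ ν)
    (hx : 0 < radius x) (ha : HasDerivAt a a' (radius x)) (hp : HasDerivAt p p' (radius x))
    (ha0 : a (radius x) ≠ 0) (hp0 : 1 + p (radius x) * radius x ^ 2 ≠ 0) (ρ μ ν : Fin 4) :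
    christoffel g ρ μ ν x =
      spatial x ρ * frameTensor (-(a' / (2 * radius x * (1 + p (radius x) * radius x ^ 2))))
          (p (radius x) / (1 + p (radius x) * radius x ^ 2))
          (p' / (2 * radius x * (1 + p (radius x) * radius x ^ 2))) x μ ν
        + dx 0 ρ * (a' / (2 * radius x * a (radius x))
          * (dx 0 μ * spatial x ν + spatial x μ * dx 0 ν)) := by
  set r := radius x
  have hpd : ∀ κ μ ν, pd κ (fun y => g y μ ν) x =
      frameTensor (a' / r) (0 / r) (p' / r) x μ ν * spatial x κ
        + p r * (spaceDelta κ μ * spatial x ν + spatial x μ * spaceDelta κ ν) := fun κ μ ν => by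
    simp only [hg]
    exact (hasPartials_frameTensor hx ha (hasDerivAt_const r 1) hp μ ν).2 κ
  have hterm : ∀ σ, (g x)⁻¹ ρ σ * (pd μ (fun y => g y ν σ) x + pd ν (fun y => g y μ σ) x
      - pd σ (fun y => g y μ ν) x) =
      a' / r * (dx 0 μ * spatial x ν + spatial x μ * dx 0 ν)
        * (frameTensor (a r)⁻¹ 1 (-(p r / (1 + p r * r ^ 2))) x ρ σ * dx 0 σ)
      + frameTensor (-(a' / r)) (2 * p r) (p' / r) x μ ν
        * (frameTensor (a r)⁻¹ 1 (-(p r / (1 + p r * r ^ 2))) x ρ σ * spatial x σ) := fun σ => by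
    rw [inv_frameTensor_apply (hg x) ha0 hp0, hpd, hpd, hpd, spaceDelta_comm ν μ,
      spaceDelta_comm σ μ, spaceDelta_comm σ ν]
    simp only [frameTensor]
    ring
  rw [christoffel, Finset.sum_congr rfl fun σ _ => hterm σ, Finset.sum_add_distrib,
    ← Finset.mul_sum, ← Finset.mul_sum, sum_frameTensor_mul_dx_zero, sum_frameTensor_mul_spatial]
  have hinv : 1 + -(p r / (1 + p r * r ^ 2)) * r ^ 2 = 1 / (1 + p r * r ^ 2) := by
    field_simp
    ring
  rw [hinv]
  unfold frameTensor
  field_simp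
  ring

end FrameMetric

/-- The coefficient of `x^ρ δ_{ij}` in the Cartesian connection coefficients. -/
def deltaCoeff (β : ℝ → ℝ) (r : ℝ) : ℝ := (1 - Real.exp (-(2 * β r))) / r ^ 2

/-- The coefficient of `x^ρ x_i x_j` in the Cartesian connection coefficients. -/
def shearCoeff (β : ℝ → ℝ) (r : ℝ) : ℝ :=
  deriv β r / r ^ 3 - (1 - Real.exp (-(2 * β r))) / r ^ 4

/-- The coefficient of `x_i` in `Γ^t_{ti}`. -/
def redshiftCoeff (α : ℝ → ℝ) (r : ℝ) : ℝ := deriv α r / r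

/-- The coefficient of `x^i` in `Γ^i_{tt}`, the acceleration of a static observer. -/
def accelCoeff (c : ℝ) (α β : ℝ → ℝ) (r : ℝ) : ℝ :=
  c ^ 2 * Real.exp (2 * α r) * Real.exp (-(2 * β r)) * deriv α r / r

section Coefficients

variable {α β : ℝ → ℝ} {α₁ α₂ β₁ r : ℝ}

theorem hasDerivAt_deltaCoeff (hr : r ≠ 0) (hβ : HasDerivAt β β₁ r) :
    HasDerivAt (deltaCoeff β) (2 * β₁ * Real.exp (-(2 * β r)) / r ^ 2
      - 2 * (1 - Real.exp (-(2 * β r))) / r ^ 3) r := by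
  have hexp : HasDerivAt (fun s => 1 - Real.exp (-(2 * β s))) _ r :=
    (hβ.const_mul 2).fun_neg.exp.const_sub 1
  refine (hexp.fun_div (hasDerivAt_pow 2 r) (pow_ne_zero 2 hr)).congr_deriv ?_
  field_simp
  push_cast
  ring

theorem differentiableAt_shearCoeff (hr : r ≠ 0) (hβ : DifferentiableAt ℝ β r)
    (hβ' : DifferentiableAt ℝ (deriv β) r) : DifferentiableAt ℝ (shearCoeff β) r := by
  unfold shearCoeff
  fun_prop (disch := positivity)

theorem hasDerivAt_redshiftCoeff (hr : r ≠ 0) (hα' : HasDerivAt (deriv α) α₂ r) :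
    HasDerivAt (redshiftCoeff α) (α₂ / r - deriv α r / r ^ 2) r := by
  refine (hα'.fun_div (hasDerivAt_id' r) hr).congr_deriv ?_
  field_simp

theorem hasDerivAt_accelCoeff (c : ℝ) (hr : r ≠ 0) (hα : HasDerivAt α α₁ r)
    (hα' : HasDerivAt (deriv α) α₂ r) (hβ : HasDerivAt β β₁ r) :
    HasDerivAt (accelCoeff c α β) (c ^ 2 * Real.exp (2 * α r) * Real.exp (-(2 * β r)) *
      ((2 * (α₁ - β₁) * deriv α r + α₂) / r - deriv α r / r ^ 2)) r := by
  have hexp : HasDerivAt (fun s => c ^ 2 * Real.exp (2 * α s) * Real.exp (-(2 * β s))) _ r :=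
    ((hα.const_mul 2).exp.const_mul (c ^ 2)).fun_mul (hβ.const_mul 2).fun_neg.exp
  refine ((hexp.fun_mul hα').fun_div (hasDerivAt_id' r) hr).congr_deriv ?_
  field_simp
  ring

end Coefficients

theorem cartesianMetric_apply (c : ℝ) (α β : ℝ → ℝ) (x : Coord) (μ ν : Fin 4) :
    cartesianMetric c α β x μ ν = frameTensor (-(c ^ 2 * Real.exp (2 * α (radius x)))) 1
      ((Real.exp (2 * β (radius x)) - 1) / radius x ^ 2) x μ ν := by
  fin_cases μ <;> fin_cases ν <;>
    simp [cartesianMetric, radialForm, spatial, dx, spaceDelta, frameTensor] <;> ring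

/-- The component `G^t_t` of the Einstein tensor as a function of the radius. -/
def einsteinTT (β : ℝ → ℝ) (r : ℝ) : ℝ :=
  Real.exp (-(2 * β r)) * (1 - Real.exp (2 * β r) - 2 * r * deriv β r) / r ^ 2

/-- The component `G^r_r` of the Einstein tensor as a function of the radius. -/
def einsteinRR (α β : ℝ → ℝ) (r : ℝ) : ℝ :=
  Real.exp (-(2 * β r)) * (1 - Real.exp (2 * β r) + 2 * r * deriv α r) / r ^ 2

/-- The component `G^θ_θ = G^φ_φ` of the Einstein tensor as a function of the radius. -/
def einsteinAngular (α β : ℝ → ℝ) (r : ℝ) : ℝ :=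
  Real.exp (-(2 * β r)) *
    ((1 + r * deriv α r) * (deriv α r - deriv β r) + r * deriv (deriv α) r) / r

theorem differentiableAt_of_contDiffOn_Ioi {f : ℝ → ℝ} {n : WithTop ℕ∞} {r : ℝ}
    (hf : ContDiffOn ℝ n f (Ioi 0)) (hn : n ≠ 0) (hr : 0 < r) : DifferentiableAt ℝ f r :=
  (hf.differentiableOn hn).differentiableAt (Ioi_mem_nhds hr)

theorem contDiffOn_deriv_Ioi {f : ℝ → ℝ} {n : WithTop ℕ∞}
    (hf : ContDiffOn ℝ (n + 1) f (Ioi 0)) : ContDiffOn ℝ n (deriv f) (Ioi 0) :=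
  hf.deriv_of_isOpen isOpen_Ioi le_rfl

section CartesianMetric

variable {c : ℝ} {α β : ℝ → ℝ} {x : Coord}

theorem christoffel_cartesianMetric (hc : c ≠ 0) (hx : 0 < radius x)
    (hα : DifferentiableAt ℝ α (radius x)) (hβ : DifferentiableAt ℝ β (radius x))
    (ρ μ ν : Fin 4) :
    christoffel (cartesianMetric c α β) ρ μ ν x =
      radialConnection (deltaCoeff β) (shearCoeff β) (redshiftCoeff α) (accelCoeff c α β)
        ρ μ ν x := by
  have ha : HasDerivAt (fun r => -(c ^ 2 * Real.exp (2 * α r))) _ (radius x) :=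
    ((hα.hasDerivAt.const_mul 2).exp.const_mul (c ^ 2)).fun_neg
  have hp : HasDerivAt (fun r => (Real.exp (2 * β r) - 1) / r ^ 2) _ (radius x) :=
    ((hβ.hasDerivAt.const_mul 2).exp.sub_const 1).fun_div (hasDerivAt_pow 2 (radius x))
      (by positivity)
  have hrr : 1 + (Real.exp (2 * β (radius x)) - 1) / radius x ^ 2 * radius x ^ 2 =
      Real.exp (2 * β (radius x)) := by
    field_simp
    ring
  rw [christoffel_eq_of_frameTensor (cartesianMetric_apply c α β) hx ha hp
    (by simp [hc]) (by rw [hrr]; positivity), hrr, radialConnection]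
  congr 2
  · simp only [deltaCoeff, shearCoeff, accelCoeff, Real.exp_neg]
    congr 1
    · field_simp
    · field_simp
    · field_simp
      push_cast
      ring
  · rw [redshiftCoeff]
    field_simp

theorem inv_cartesianMetric (hc : c ≠ 0) (α β : ℝ → ℝ) (hx : 0 < radius x) (μ ν : Fin 4) :
    (cartesianMetric c α β x)⁻¹ μ ν =
      frameTensor (-(c ^ 2 * Real.exp (2 * α (radius x))))⁻¹ 1 (-deltaCoeff β (radius x))
        x μ ν := by
  have hrr : 1 + (Real.exp (2 * β (radius x)) - 1) / radius x ^ 2 * radius x ^ 2 =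
      Real.exp (2 * β (radius x)) := by
    field_simp
    ring
  rw [inv_frameTensor_apply (cartesianMetric_apply c α β x) (by simp [hc])
    (by rw [hrr]; positivity), hrr, deltaCoeff, Real.exp_neg]
  congr 2
  field_simp

theorem einstein_cartesianMetric (hc : c ≠ 0) (hα : ContDiffOn ℝ 2 α (Ioi 0))
    (hβ : ContDiffOn ℝ 2 β (Ioi 0)) (hx : 0 < radius x) (μ ν : Fin 4) :
    einstein (cartesianMetric c α β) μ ν x =
      frameTensor (einsteinTT β (radius x)) (einsteinAngular α β (radius x))
        ((einsteinRR α β (radius x) - einsteinAngular α β (radius x)) / radius x ^ 2) x μ ν := by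
  have dα : ∀ {r : ℝ}, 0 < r → DifferentiableAt ℝ α r :=
    differentiableAt_of_contDiffOn_Ioi hα two_ne_zero
  have dβ : ∀ {r : ℝ}, 0 < r → DifferentiableAt ℝ β r :=
    differentiableAt_of_contDiffOn_Ioi hβ two_ne_zero
  have dα' : DifferentiableAt ℝ (deriv α) (radius x) :=
    differentiableAt_of_contDiffOn_Ioi (contDiffOn_deriv_Ioi (n := 1) hα) one_ne_zero hx
  have dβ' : DifferentiableAt ℝ (deriv β) (radius x) :=
    differentiableAt_of_contDiffOn_Ioi (contDiffOn_deriv_Ioi (n := 1) hβ) one_ne_zero hx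
  have hricci := ricci_eq_of_radialConnection hx
    (fun y hy => christoffel_cartesianMetric hc hy (dα hy) (dβ hy))
    (hasDerivAt_deltaCoeff hx.ne' (dβ hx).hasDerivAt)
    (differentiableAt_shearCoeff hx.ne' (dβ hx) dβ').hasDerivAt
    (hasDerivAt_redshiftCoeff hx.ne' dα'.hasDerivAt)
    (hasDerivAt_accelCoeff c hx.ne' (dα hx).hasDerivAt dα'.hasDerivAt (dβ hx).hasDerivAt)
  simp only [einstein, scalarCurvature, ricciMixed, hricci, inv_cartesianMetric hc α β hx,
    sum_frameTensor_mul, sum_frameTensor_self, one_eq_frameTensor x]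
  simp only [frameTensor, einsteinTT, einsteinRR, einsteinAngular, deltaCoeff, shearCoeff,
    redshiftCoeff, accelCoeff, Real.exp_neg]
  field_simp
  ring

theorem volDensity_cartesianMetric (c : ℝ) (α β : ℝ → ℝ) (hx : 0 < radius x) :
    volDensity (cartesianMetric c α β) x = |c| * Real.exp (α (radius x) + β (radius x)) := by
  have hm : cartesianMetric c α β x = Matrix.of (frameTensor _ 1 _ x) :=
    Matrix.ext fun μ ν => cartesianMetric_apply c α β x μ ν
  have hdet : (cartesianMetric c α β x).det =
      -(c * Real.exp (α (radius x) + β (radius x))) ^ 2 := by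
    rw [hm, det_frameTensor, mul_pow, ← Real.exp_nat_mul, Nat.cast_ofNat, mul_add 2 (α _),
      Real.exp_add]
    field_simp
    ring
  rw [volDensity, hdet, abs_neg, abs_sq, Real.sqrt_sq_eq_abs, abs_mul, Real.abs_exp]

end CartesianMetric

/-! ### The Einstein tensor in spherical coordinates -/

theorem inv_diagonal_apply {d : Fin 4 → ℝ} (hd : ∀ i, d i ≠ 0) (μ ν : Fin 4) :
    (Matrix.diagonal d)⁻¹ μ ν = if μ = ν then (d μ)⁻¹ else 0 := by
  suffices (Matrix.diagonal d)⁻¹ = Matrix.diagonal d⁻¹ by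
    rw [this, Matrix.diagonal_apply, Pi.inv_apply]
  refine Matrix.inv_eq_right_inv ?_
  rw [Matrix.diagonal_mul_diagonal, ← Matrix.diagonal_one]
  exact congrArg _ (funext fun i => mul_inv_cancel₀ (hd i))

theorem pd_diagonal (d : Coord → Fin 4 → ℝ) (κ μ ν : Fin 4) (x : Coord) :
    pd κ (fun y => Matrix.diagonal (d y) μ ν) x =
      if μ = ν then pd κ (fun y => d y μ) x else 0 := by
  split_ifs with h
  · subst h
    simp only [Matrix.diagonal_apply_eq]
  · simp only [Matrix.diagonal_apply_ne _ h]
    exact (HasPartials.const 0 x).2 κ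

theorem christoffel_diagonal {d : Coord → Fin 4 → ℝ} {x : Coord} (hd : ∀ i, d x i ≠ 0)
    (ρ μ ν : Fin 4) :
    christoffel (fun y => Matrix.diagonal (d y)) ρ μ ν x = 1 / 2 * ((d x ρ)⁻¹ *
      ((if ν = ρ then pd μ (fun y => d y ν) x else 0)
        + (if μ = ρ then pd ν (fun y => d y μ) x else 0)
        - (if μ = ν then pd ρ (fun y => d y μ) x else 0))) := by
  simp only [christoffel, inv_diagonal_apply hd, pd_diagonal, ite_mul, zero_mul,
    Finset.sum_ite_eq, Finset.mem_univ, if_true]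

/-- The region on which the spherical coordinates `(t, r, θ, φ)` are regular. -/
def sphericalChart : Set Coord := {y | 0 < y 1 ∧ 0 < Real.sin (y 2)}

theorem isOpen_sphericalChart : IsOpen sphericalChart :=
  (isOpen_lt continuous_const (continuous_apply 1)).inter
    (isOpen_lt continuous_const (Real.continuous_sin.comp (continuous_apply 2)))

/-- The point `t = 0`, `θ = π / 2`, `φ = 0` at radius `r`, in spherical coordinates. -/
def equator (r : ℝ) : Coord := ![0, r, Real.pi / 2, 0]

theorem equator_mem_sphericalChart {r : ℝ} (hr : 0 < r) : equator r ∈ sphericalChart := by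
  simp [sphericalChart, equator, hr]

/-- The coefficients `Γ^ρ_{μν}` of a static, spherically symmetric connection in spherical
coordinates: `Γ^t_{tr} = A`, `Γ^r_{tt} = W`, `Γ^r_{rr} = B`, `Γ^r_{θθ} = -N`, and the angular
coefficients of Euclidean space. -/
def sphericalConnection (A B N W : ℝ → ℝ) (ρ μ ν : Fin 4) (y : Coord) : ℝ :=
  A (y 1) * (dx 0 ρ * (dx 0 μ * dx 1 ν + dx 1 μ * dx 0 ν))
    + W (y 1) * (dx 1 ρ * (dx 0 μ * dx 0 ν))
    + B (y 1) * (dx 1 ρ * (dx 1 μ * dx 1 ν))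
    + N (y 1) * (-dx 1 ρ * (dx 2 μ * dx 2 ν))
    + N (y 1) * (Real.sin (y 2) ^ 2 * (-dx 1 ρ * (dx 3 μ * dx 3 ν)))
    + (y 1)⁻¹ * (dx 2 ρ * (dx 1 μ * dx 2 ν + dx 2 μ * dx 1 ν)
      + dx 3 ρ * (dx 1 μ * dx 3 ν + dx 3 μ * dx 1 ν))
    + Real.sin (y 2) * Real.cos (y 2) * (-dx 2 ρ * (dx 3 μ * dx 3 ν))
    + Real.cos (y 2) / Real.sin (y 2) * (dx 3 ρ * (dx 2 μ * dx 3 ν + dx 3 μ * dx 2 ν))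

section SphericalConnection

variable {A B N W : ℝ → ℝ} {A' B' N' W' r : ℝ}

theorem hasPartials_sphericalConnection (hr : r ≠ 0) (hA : HasDerivAt A A' r)
    (hB : HasDerivAt B B' r) (hN : HasDerivAt N N' r) (hW : HasDerivAt W W' r) (ρ μ ν : Fin 4) :
    HasPartials (sphericalConnection A B N W ρ μ ν) (fun κ =>
      dx 1 κ * (A' * (dx 0 ρ * (dx 0 μ * dx 1 ν + dx 1 μ * dx 0 ν))
        + W' * (dx 1 ρ * (dx 0 μ * dx 0 ν)) + B' * (dx 1 ρ * (dx 1 μ * dx 1 ν))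
        - N' * (dx 1 ρ * (dx 2 μ * dx 2 ν + dx 3 μ * dx 3 ν))
        - (r ^ 2)⁻¹ * (dx 2 ρ * (dx 1 μ * dx 2 ν + dx 2 μ * dx 1 ν)
          + dx 3 ρ * (dx 1 μ * dx 3 ν + dx 3 μ * dx 1 ν)))
      + dx 2 κ * (dx 2 ρ * (dx 3 μ * dx 3 ν)
        - dx 3 ρ * (dx 2 μ * dx 3 ν + dx 3 μ * dx 2 ν))) (equator r) := by
  have hradial : ∀ {f : ℝ → ℝ} {f' : ℝ}, HasDerivAt f f' r → ∀ k : ℝ,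
      HasPartials (fun y => f (y 1) * k) (fun κ => f' * dx 1 κ * k + f r * 0) (equator r) :=
    fun hf k => (HasPartials.comp (f := fun y => y 1) hf (.coord 1 _)).mul (.const k _)
  have hpolar : ∀ {f : ℝ → ℝ} {f' : ℝ}, HasDerivAt f f' (Real.pi / 2) → ∀ k : ℝ,
      HasPartials (fun y => f (y 2) * k) (fun κ => f' * dx 2 κ * k + f (Real.pi / 2) * 0)
        (equator r) :=
    fun hf k => (HasPartials.comp (f := fun y => y 2) hf (.coord 2 _)).mul (.const k _)
  have hsin := Real.hasDerivAt_sin (Real.pi / 2)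
  have hcos := Real.hasDerivAt_cos (Real.pi / 2)
  have hcot := hcos.fun_div hsin (by simp)
  have hNsin := (HasPartials.comp (f := fun y => y 1) (x := equator r) hN (.coord 1 _)).mul
    (hpolar (hsin.fun_pow 2) (-dx 1 ρ * (dx 3 μ * dx 3 ν)))
  refine ((((((((hradial hA _).add (hradial hW _)).add (hradial hB _)).add (hradial hN _)).add
    hNsin).add (hradial (hasDerivAt_inv hr) _)).add (hpolar (hsin.fun_mul hcos) _)).add
      (hpolar hcot _)).congr_partials fun κ => ?_
  simp only [mul_zero, add_zero, neg_mul, mul_neg, equator, Matrix.cons_val, Real.sin_pi_div_two,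
    one_pow, one_mul, Nat.cast_ofNat, Nat.add_one_sub_one, mul_one, Real.cos_pi_div_two, zero_mul,
    neg_zero, zero_add, neg_neg, sub_zero, div_one]
  ring

theorem ricci_eq_of_sphericalConnection {g : MetricField} (hr : 0 < r)
    (hg : ∀ y ∈ sphericalChart, ∀ ρ μ ν,
      christoffel g ρ μ ν y = sphericalConnection A B N W ρ μ ν y)
    (hA : HasDerivAt A A' r) (hB : HasDerivAt B B' r) (hN : HasDerivAt N N' r)
    (hW : HasDerivAt W W' r) (μ : Fin 4) :
    ricci g μ μ (equator r) =
      ![W' + (B r - A r + 2 / r) * W r, -A' - A r ^ 2 + A r * B r + 2 * B r / r,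
        1 - N' - (A r + B r) * N r, 1 - N' - (A r + B r) * N r] μ := by
  have hmem := equator_mem_sphericalChart hr
  have hpd : ∀ κ ρ μ ν, pd κ (christoffel g ρ μ ν) (equator r) = _ := fun κ ρ μ ν =>
    ((hasPartials_sphericalConnection hr.ne' hA hB hN hW ρ μ ν).congr
      ((isOpen_sphericalChart.eventually_mem hmem).mono fun y hy => hg y hy ρ μ ν)
      fun _ => rfl).2 κ
  simp only [ricci, riemann, hpd, hg _ hmem, sphericalConnection, Fin.sum_univ_four]
  fin_cases μ <;> simp [dx, equator] <;> field_simp <;> ring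

end SphericalConnection

section SphericalMetric

variable {c r : ℝ} {α β : ℝ → ℝ}

theorem christoffel_sphericalMetric (hc : c ≠ 0) {y : Coord} (hy : y ∈ sphericalChart)
    (hα : DifferentiableAt ℝ α (y 1)) (hβ : DifferentiableAt ℝ β (y 1)) (ρ μ ν : Fin 4) :
    christoffel (sphericalMetric c α β) ρ μ ν y =
      sphericalConnection (deriv α) (deriv β) (fun s => s * Real.exp (-(2 * β s)))
        (fun s => s * accelCoeff c α β s) ρ μ ν y := by
  have hr : y 1 ≠ 0 := hy.1.ne'
  have hsin : Real.sin (y 2) ≠ 0 := hy.2.ne'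
  have htt := HasPartials.comp (f := fun z => z 1)
    ((hα.hasDerivAt.const_mul 2).exp.const_mul (c ^ 2)).fun_neg (.coord 1 y)
  have hrr := HasPartials.comp (f := fun z => z 1) (hβ.hasDerivAt.const_mul 2).exp (.coord 1 y)
  have hθθ := HasPartials.comp (f := fun z => z 1) (hasDerivAt_pow 2 (y 1)) (.coord 1 y)
  have hφφ := hθθ.mul
    (HasPartials.comp (f := fun z => z 2) ((Real.hasDerivAt_sin (y 2)).fun_pow 2) (.coord 2 y))
  unfold sphericalMetric
  rw [christoffel_diagonal fun i => by fin_cases i <;> simp [hc, hr, hsin]]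
  unfold sphericalConnection accelCoeff
  fin_cases ρ <;> fin_cases μ <;> fin_cases ν <;>
    simp [dx, htt.2, hrr.2, hθθ.2, hφφ.2, Real.exp_neg] <;> field_simp

theorem sphericalEinstein_eq (hc : c ≠ 0) (hα : ContDiffOn ℝ 2 α (Ioi 0))
    (hβ : ContDiffOn ℝ 2 β (Ioi 0)) (hr : 0 < r) (μ : Fin 4) :
    sphericalEinstein c α β μ μ r =
      ![einsteinTT β r, einsteinRR α β r, einsteinAngular α β r, einsteinAngular α β r] μ := by
  have dα : ∀ {r : ℝ}, 0 < r → DifferentiableAt ℝ α r :=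
    differentiableAt_of_contDiffOn_Ioi hα two_ne_zero
  have dβ : ∀ {r : ℝ}, 0 < r → DifferentiableAt ℝ β r :=
    differentiableAt_of_contDiffOn_Ioi hβ two_ne_zero
  have dα' : DifferentiableAt ℝ (deriv α) r :=
    differentiableAt_of_contDiffOn_Ioi (contDiffOn_deriv_Ioi (n := 1) hα) one_ne_zero hr
  have dβ' : DifferentiableAt ℝ (deriv β) r :=
    differentiableAt_of_contDiffOn_Ioi (contDiffOn_deriv_Ioi (n := 1) hβ) one_ne_zero hr
  have hricci := ricci_eq_of_sphericalConnection hr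
    (fun y hy => christoffel_sphericalMetric hc hy (dα hy.1) (dβ hy.1))
    dα'.hasDerivAt dβ'.hasDerivAt
    ((hasDerivAt_id' r).fun_mul ((dβ hr).hasDerivAt.const_mul 2).fun_neg.exp)
    ((hasDerivAt_id' r).fun_mul
      (hasDerivAt_accelCoeff c hr.ne' (dα hr).hasDerivAt dα'.hasDerivAt (dβ hr).hasDerivAt))
  have hmixed : ∀ μ, ricciMixed (sphericalMetric c α β) μ μ (equator r) =
      ![-(c ^ 2 * Real.exp (2 * α r))⁻¹, Real.exp (-(2 * β r)), (r ^ 2)⁻¹, (r ^ 2)⁻¹] μ *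
        ricci (sphericalMetric c α β) μ μ (equator r) := fun μ => by
    have hinv : ∀ κ, (sphericalMetric c α β (equator r))⁻¹ μ κ = _ :=
      inv_diagonal_apply (fun i => by fin_cases i <;> simp [equator, hc, hr.ne']) μ
    simp only [ricciMixed, hinv, ite_mul, zero_mul, Finset.sum_ite_eq, Finset.mem_univ, if_true]
    fin_cases μ <;> simp [equator, Real.exp_neg]
  change einstein _ μ μ (equator r) = _
  simp only [einstein, scalarCurvature, hmixed, hricci, Fin.sum_univ_four, accelCoeff,
    einsteinTT, einsteinRR, einsteinAngular, Real.exp_neg]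
  fin_cases μ <;> simp <;> field_simp <;> ring

end SphericalMetric

/-! ### The contracted Bianchi identity -/

/-- The Euclidean divergence `∂_μ F^μ`. -/
def divergence (F : Coord → Coord) (x : Coord) : ℝ := ∑ μ, pd μ (fun y => F y μ) x

theorem sum_pd_contraction {T : Fin 4 → Fin 4 → Coord → ℝ} {Γ : Fin 4 → Fin 4 → Fin 4 → ℝ}
    {ψ : Coord → Coord} {x : Coord} (hT : ∀ μ ν, DifferentiableAt ℝ (T μ ν) x)
    (hψ : DifferentiableAt ℝ ψ x)
    (hdiv : ∀ ν, ∑ μ, pd μ (T μ ν) x = ∑ μ, ∑ κ, T μ κ x * Γ κ μ ν) :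
    ∑ μ, pd μ (fun y => ∑ ν, T μ ν y * ψ y ν) x =
      ∑ μ, ∑ ν, T μ ν x * (pd μ (fun y => ψ y ν) x + ∑ κ, Γ ν μ κ * ψ x κ) := by
  have hpd : ∀ μ, pd μ (fun y => ∑ ν, T μ ν y * ψ y ν) x =
      ∑ ν, (pd μ (T μ ν) x * ψ x ν + T μ ν x * pd μ (fun y => ψ y ν) x) := fun μ =>
    (HasPartials.sum fun ν _ => (HasPartials.of_differentiableAt (hT μ ν)).mul
      (.of_differentiableAt (differentiableAt_pi.1 hψ ν))).2 μ
  have hdivψ : ∑ μ, ∑ ν, pd μ (T μ ν) x * ψ x ν =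
      ∑ μ, ∑ ν, T μ ν x * ∑ κ, Γ ν μ κ * ψ x κ := by
    rw [Finset.sum_comm]
    simp only [← Finset.sum_mul, hdiv]
    simp only [Finset.sum_mul, Finset.mul_sum, mul_assoc]
    rw [Finset.sum_comm]
    exact Finset.sum_congr rfl fun μ _ => Finset.sum_comm
  simp only [hpd, mul_add, Finset.sum_add_distrib, hdivψ]
  rw [add_comm]

theorem mul_frameTensor (k a b p : ℝ) (x : Coord) (μ ν : Fin 4) :
    k * frameTensor a b p x μ ν = frameTensor (k * a) (k * b) (k * p) x μ ν := by
  unfold frameTensor; ring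

theorem sum_frameTensor_mul_radialConnection (a b p : ℝ) (P Q U V : ℝ → ℝ) (x : Coord)
    (ν : Fin 4) :
    ∑ μ, ∑ κ, frameTensor a b p x μ κ * radialConnection P Q U V κ μ ν x =
      (a * U (radius x) + (b + p * radius x ^ 2) * (P (radius x) + Q (radius x) * radius x ^ 2))
        * spatial x ν := by
  set r := radius x
  have hinner : ∀ μ, ∑ κ, frameTensor a b p x μ κ * radialConnection P Q U V κ μ ν x =
      (b + p * r ^ 2) * (frameTensor (V r) (P r) (Q r) x ν μ * spatial x μ)
        + a * U r * spatial x ν * (dx 0 μ * dx 0 μ)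
        + a * U r * dx 0 ν * (spatial x μ * dx 0 μ) := fun μ => by
    have hterm : ∀ κ, frameTensor a b p x μ κ * radialConnection P Q U V κ μ ν x =
        frameTensor a b p x μ κ * spatial x κ * frameTensor (V r) (P r) (Q r) x ν μ
          + frameTensor a b p x μ κ * dx 0 κ
            * (U r * (dx 0 μ * spatial x ν + spatial x μ * dx 0 ν)) := fun κ => by
      rw [radialConnection, frameTensor_comm (V r)]; ring
    simp only [hterm, Finset.sum_add_distrib, ← Finset.sum_mul, sum_frameTensor_mul_spatial,
      sum_frameTensor_mul_dx_zero]
    ring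
  simp only [hinner, Finset.sum_add_distrib, ← Finset.mul_sum, sum_frameTensor_mul_spatial,
    sum_dx_zero_mul_dx_zero, sum_spatial_mul_dx_zero]
  ring

section Regularity

variable {n : WithTop ℕ∞}

theorem contDiffOn_radius : ContDiffOn ℝ n radius offAxis := by
  refine ContDiffOn.sqrt (by fun_prop) fun x hx => ?_
  rw [← radius_sq]
  exact pow_ne_zero 2 (ne_of_gt hx)

theorem contDiff_spatial (i : Fin 4) : ContDiff ℝ n fun y => spatial y i := by
  fin_cases i
  exacts [contDiff_const, contDiff_apply .., contDiff_apply .., contDiff_apply ..]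

theorem contDiffOn_frameTensor {a b p : ℝ → ℝ} (ha : ContDiffOn ℝ n a (Ioi 0))
    (hb : ContDiffOn ℝ n b (Ioi 0)) (hp : ContDiffOn ℝ n p (Ioi 0)) (μ ν : Fin 4) :
    ContDiffOn ℝ n (fun y => frameTensor (a (radius y)) (b (radius y)) (p (radius y)) y μ ν)
      offAxis := by
  have hradial : ∀ {f : ℝ → ℝ}, ContDiffOn ℝ n f (Ioi 0) →
      ContDiffOn ℝ n (fun y => f (radius y)) offAxis :=
    fun hf => hf.comp contDiffOn_radius fun _ hx => hx
  exact (((hradial ha).mul contDiffOn_const).add ((hradial hb).mul contDiffOn_const)).add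
    ((hradial hp).mul ((contDiff_spatial μ).mul (contDiff_spatial ν)).contDiffOn)

variable {α β : ℝ → ℝ}

theorem contDiffOn_exp_add (hα : ContDiffOn ℝ n α (Ioi 0)) (hβ : ContDiffOn ℝ n β (Ioi 0)) :
    ContDiffOn ℝ n (fun r => Real.exp (α r + β r)) (Ioi 0) := by
  fun_prop

theorem contDiffOn_einsteinTT (hβ : ContDiffOn ℝ (n + 1) β (Ioi 0)) :
    ContDiffOn ℝ n (einsteinTT β) (Ioi 0) := by
  have hβ' := contDiffOn_deriv_Ioi hβ
  have hβ₀ := hβ.of_le le_self_add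
  exact ContDiffOn.div (by fun_prop) (by fun_prop) fun r hr => pow_ne_zero 2 (ne_of_gt hr)

theorem contDiffOn_einsteinRR (hα : ContDiffOn ℝ (n + 1) α (Ioi 0))
    (hβ : ContDiffOn ℝ n β (Ioi 0)) : ContDiffOn ℝ n (einsteinRR α β) (Ioi 0) := by
  have hα' := contDiffOn_deriv_Ioi hα
  exact ContDiffOn.div (by fun_prop) (by fun_prop) fun r hr => pow_ne_zero 2 (ne_of_gt hr)

theorem contDiffOn_einsteinAngular (hα : ContDiffOn ℝ (n + 1 + 1) α (Ioi 0))
    (hβ : ContDiffOn ℝ (n + 1) β (Ioi 0)) : ContDiffOn ℝ n (einsteinAngular α β) (Ioi 0) := by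
  have hα' := contDiffOn_deriv_Ioi hα
  have hα'' := contDiffOn_deriv_Ioi hα'
  have hα₁ := hα'.of_le le_self_add
  have hβ' := contDiffOn_deriv_Ioi hβ
  have hβ₀ := hβ.of_le le_self_add
  exact ContDiffOn.div (by fun_prop) (by fun_prop) fun r hr => ne_of_gt hr

end Regularity

section Conservation

variable {α β : ℝ → ℝ} {r : ℝ}

theorem hasDerivAt_einsteinRR (hr : r ≠ 0) (hβ : DifferentiableAt ℝ β r)
    (hα' : DifferentiableAt ℝ (deriv α) r) :
    HasDerivAt (einsteinRR α β) (-(deriv α r * (einsteinRR α β r - einsteinTT β r))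
      - 2 * (einsteinRR α β r - einsteinAngular α β r) / r) r := by
  have h2r : HasDerivAt (fun s : ℝ => 2 * s) 2 r := by
    simpa using (hasDerivAt_id r).const_mul (2 : ℝ)
  refine (((hβ.hasDerivAt.const_mul 2).fun_neg.exp.fun_mul
    (((hβ.hasDerivAt.const_mul 2).exp.const_sub 1).fun_add (h2r.fun_mul hα'.hasDerivAt))).fun_div
      (hasDerivAt_pow 2 r) (by positivity)).congr_deriv ?_
  simp only [einsteinRR, einsteinTT, einsteinAngular, Real.exp_neg]
  field_simp
  push_cast
  ring

/-- The Einstein tensor density `e^{α+β} G^μ_ν` in Cartesian coordinates, off the time axis. -/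
def einsteinDensity (α β : ℝ → ℝ) (μ ν : Fin 4) (x : Coord) : ℝ :=
  frameTensor (Real.exp (α (radius x) + β (radius x)) * einsteinTT β (radius x))
    (Real.exp (α (radius x) + β (radius x)) * einsteinAngular α β (radius x))
    (Real.exp (α (radius x) + β (radius x)) *
      ((einsteinRR α β (radius x) - einsteinAngular α β (radius x)) / radius x ^ 2)) x μ ν

/-- The vector field `e^{α+β} G^μ_ν ψ^ν`, whose Euclidean divergence is the integrand of the
weak Bianchi identity. -/
def einsteinFlux (α β : ℝ → ℝ) (ψ : Coord → Coord) (x : Coord) : Coord := fun μ =>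
  ∑ ν, einsteinDensity α β μ ν x * ψ x ν

theorem contDiffOn_einsteinDensity (hα : ContDiffOn ℝ 3 α (Ioi 0)) (hβ : ContDiffOn ℝ 2 β (Ioi 0))
    (μ ν : Fin 4) : ContDiffOn ℝ 1 (einsteinDensity α β μ ν) offAxis := by
  have hexp := contDiffOn_exp_add (hα.of_le (m := 1) (by norm_num)) (hβ.of_le (by norm_num))
  have hTT := contDiffOn_einsteinTT (n := 1) hβ
  have hRR := contDiffOn_einsteinRR (n := 1) (hα.of_le (by norm_num)) (hβ.of_le (by norm_num))
  have hang := contDiffOn_einsteinAngular (n := 1) (hα.of_le (by norm_num)) hβ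
  exact contDiffOn_frameTensor (hexp.mul hTT) (hexp.mul hang)
    (hexp.mul ((hRR.sub hang).div (by fun_prop) fun r hr => pow_ne_zero 2 (ne_of_gt hr))) μ ν

theorem sum_pd_einsteinDensity {x : Coord} (hα : ContDiffOn ℝ 3 α (Ioi 0))
    (hβ : ContDiffOn ℝ 2 β (Ioi 0)) (hx : 0 < radius x) (c : ℝ) (ν : Fin 4) :
    ∑ μ, pd μ (einsteinDensity α β μ ν) x = ∑ μ, ∑ κ, einsteinDensity α β μ κ x *
      radialConnection (deltaCoeff β) (shearCoeff β) (redshiftCoeff α) (accelCoeff c α β)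
        κ μ ν x := by
  have dα := differentiableAt_of_contDiffOn_Ioi hα three_ne_zero hx
  have dβ := differentiableAt_of_contDiffOn_Ioi hβ two_ne_zero hx
  have dα' := differentiableAt_of_contDiffOn_Ioi (contDiffOn_deriv_Ioi (n := 2) hα) two_ne_zero hx
  have hexp : HasDerivAt (fun s => Real.exp (α s + β s)) _ (radius x) :=
    (dα.hasDerivAt.fun_add dβ.hasDerivAt).exp
  have hTT := (differentiableAt_of_contDiffOn_Ioi (contDiffOn_einsteinTT (n := 1) hβ) one_ne_zero
    hx).hasDerivAt
  have hang := (differentiableAt_of_contDiffOn_Ioi (contDiffOn_einsteinAngular (n := 1) hα hβ)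
    one_ne_zero hx).hasDerivAt
  have hRR := hasDerivAt_einsteinRR hx.ne' dβ dα'
  unfold einsteinDensity
  rw [sum_pd_frameTensor hx (hexp.fun_mul hTT) (hexp.fun_mul hang) (hexp.fun_mul
      ((hRR.fun_sub hang).fun_div (hasDerivAt_pow 2 (radius x)) (by positivity))),
    sum_frameTensor_mul_radialConnection, deltaCoeff, shearCoeff, redshiftCoeff]
  congr 1
  field_simp
  push_cast
  ring

theorem bianchiIntegrand_eq_divergence {c : ℝ} (hc : c ≠ 0) (hα : ContDiffOn ℝ 3 α (Ioi 0))
    (hβ : ContDiffOn ℝ 2 β (Ioi 0)) {ψ : Coord → Coord} {x : Coord} (hx : 0 < radius x)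
    (hψ : DifferentiableAt ℝ ψ x) :
    bianchiIntegrand c α β ψ x = |c| * divergence (einsteinFlux α β ψ) x := by
  have dα := differentiableAt_of_contDiffOn_Ioi hα three_ne_zero hx
  have dβ := differentiableAt_of_contDiffOn_Ioi hβ two_ne_zero hx
  have dT : ∀ μ ν, DifferentiableAt ℝ (einsteinDensity α β μ ν) x := fun μ ν =>
    ((contDiffOn_einsteinDensity hα hβ μ ν).differentiableOn one_ne_zero).differentiableAt
      (isOpen_offAxis.mem_nhds hx)
  simp only [divergence, einsteinFlux]
  rw [sum_pd_contraction dT hψ (sum_pd_einsteinDensity hα hβ hx c)]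
  simp only [bianchiIntegrand, covDeriv, volDensity_cartesianMetric c α β hx,
    einstein_cartesianMetric hc (hα.of_le (by norm_num)) hβ hx,
    christoffel_cartesianMetric hc hx dα dβ, einsteinDensity, Finset.mul_sum, Finset.sum_mul,
    ← mul_frameTensor]
  refine Finset.sum_congr rfl fun μ _ => Finset.sum_congr rfl fun ν _ => ?_
  ring

theorem contDiffOn_einsteinFlux (hα : ContDiffOn ℝ 3 α (Ioi 0)) (hβ : ContDiffOn ℝ 2 β (Ioi 0))
    {ψ : Coord → Coord} (hψ : ContDiff ℝ 1 ψ) : ContDiffOn ℝ 1 (einsteinFlux α β ψ) offAxis :=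
  contDiffOn_pi.2 fun μ => ContDiffOn.sum fun ν _ =>
    (contDiffOn_einsteinDensity hα hβ μ ν).mul (contDiff_pi.1 hψ ν).contDiffOn

theorem sum_spatial_mul_einsteinFlux (α β : ℝ → ℝ) (ψ : Coord → Coord) {x : Coord}
    (hx : 0 < radius x) :
    ∑ μ, spatial x μ * einsteinFlux α β ψ x μ =
      Real.exp (α (radius x) + β (radius x)) * einsteinRR α β (radius x)
        * ∑ ν, spatial x ν * ψ x ν := by
  simp only [einsteinFlux, Finset.mul_sum]
  rw [Finset.sum_comm]
  refine Finset.sum_congr rfl fun ν _ => ?_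
  have hcontract : ∑ μ, einsteinDensity α β ν μ x * spatial x μ = _ :=
    sum_frameTensor_mul_spatial ..
  have hterm : ∀ μ, spatial x μ * (einsteinDensity α β μ ν x * ψ x ν) =
      einsteinDensity α β ν μ x * spatial x μ * ψ x ν := fun μ => by
    rw [einsteinDensity, frameTensor_comm, ← einsteinDensity]; ring
  rw [Finset.sum_congr rfl fun μ _ => hterm μ, ← Finset.sum_mul, hcontract]
  field_simp
  ring

theorem support_einsteinFlux_subset (α β : ℝ → ℝ) (ψ : Coord → Coord) :
    Function.support (einsteinFlux α β ψ) ⊆ Function.support ψ := fun x hx hψ =>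
  hx (funext fun μ => by simp [einsteinFlux, hψ])

end Conservation

/-! ### The divergence theorem off the axis -/

section Divergence

variable {F : Coord → Coord} {x : Coord}

theorem divergence_eq_zero_of_eventuallyEq (h : F =ᶠ[𝓝 x] 0) : divergence F x = 0 :=
  Finset.sum_eq_zero fun μ _ => by
    have hμ : (fun y => F y μ) =ᶠ[𝓝 x] fun _ => 0 := h.mono fun y hy => congrFun hy μ
    simp [pd, hμ.fderiv_eq]

theorem support_divergence_subset : Function.support (divergence F) ⊆ tsupport F := fun _ hx =>
  by_contra fun h => hx <|
    divergence_eq_zero_of_eventuallyEq (notMem_tsupport_iff_eventuallyEq.1 h)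

theorem continuousOn_divergence {s : Set Coord} (hs : IsOpen s) (hF : ContDiffOn ℝ 1 F s) :
    ContinuousOn (divergence F) s :=
  continuousOn_finsetSum _ fun μ _ =>
    ((contDiffOn_pi.1 hF μ).continuousOn_fderiv_of_isOpen hs le_rfl).clm_apply continuousOn_const

theorem integral_divergence_eq_zero (hF : ContDiff ℝ 1 F) (hc : HasCompactSupport F) :
    ∫ x, divergence F x = 0 := by
  have hpd : ∀ μ, Integrable (fun x => pd μ (fun y => F y μ) x) ∧
      ∫ x, pd μ (fun y => F y μ) x = 0 := fun μ => by
    have hFμ : ContDiff ℝ 1 fun y => F y μ := contDiff_pi.1 hF μ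
    have hcμ : HasCompactSupport fun y => F y μ := hc.comp_left (g := fun v : Coord => v μ) rfl
    have hint : Integrable fun x => pd μ (fun y => F y μ) x :=
      ((hFμ.continuous_fderiv one_ne_zero).clm_apply
        continuous_const).integrable_of_hasCompactSupport (hcμ.fderiv_apply (𝕜 := ℝ) _)
    have hparts := integral_mul_fderiv_eq_neg_fderiv_mul_of_integrable (f := fun _ => (1 : ℝ))
      (g := fun y => F y μ) (v := Pi.single μ 1) (μ := volume) (by simp) (by simpa [pd] using hint)
      (by simpa using hFμ.continuous.integrable_of_hasCompactSupport hcμ)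
      (fun _ _ => by fun_prop) fun x _ => hFμ.differentiable one_ne_zero x
    exact ⟨hint, by simpa [pd] using hparts⟩
  simp only [divergence]
  rw [integral_finsetSum _ fun μ _ => (hpd μ).1]
  exact Finset.sum_eq_zero fun μ _ => (hpd μ).2

theorem divergence_radial_smul {χ : ℝ → ℝ} {χ' : ℝ} (hx : 0 < radius x)
    (hχ : HasDerivAt χ χ' (radius x)) (hF : DifferentiableAt ℝ F x) :
    divergence (fun y => χ (radius y) • F y) x =
      χ (radius x) * divergence F x + χ' / radius x * ∑ μ, spatial x μ * F x μ := by
  have hpd : ∀ μ, pd μ (fun y => χ (radius y) * F y μ) x =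
      χ (radius x) * pd μ (fun y => F y μ) x + χ' / radius x * (spatial x μ * F x μ) := fun μ => by
    rw [((hasPartials_radial hx hχ).mul (.of_differentiableAt (differentiableAt_pi.1 hF μ))).2 μ]
    ring
  simp only [divergence, Pi.smul_apply, smul_eq_mul, hpd, Finset.sum_add_distrib, Finset.mul_sum]

theorem contDiff_of_off_axis {E : Type*} [NormedAddCommGroup E] [NormedSpace ℝ E]
    {n : WithTop ℕ∞} {f : Coord → E} {a : ℝ} (ha : 0 < a) (hf : ContDiffOn ℝ n f offAxis)
    (h0 : ∀ x, radius x < a → f x = 0) : ContDiff ℝ n f := by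
  refine contDiff_iff_contDiffAt.2 fun x => ?_
  by_cases hx : 0 < radius x
  · exact hf.contDiffAt (isOpen_offAxis.mem_nhds hx)
  · have hxa : radius x < a := (not_lt.1 hx).trans_lt ha
    refine (contDiffAt_const (c := (0 : E))).congr_of_eventuallyEq ?_
    filter_upwards [(isOpen_lt continuous_radius continuous_const).mem_nhds hxa] with y hy
    exact h0 y hy

theorem integrable_of_off_axis {f : Coord → ℝ} {a : ℝ} (ha : 0 < a)
    (hf : ContinuousOn f offAxis) (h0 : ∀ x, radius x < a → f x = 0) (hc : HasCompactSupport f) :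
    Integrable f :=
  (contDiff_of_off_axis ha (contDiffOn_zero.2 hf) h0).continuous.integrable_of_hasCompactSupport hc

section RadialCutoff

variable {χ : ℝ → ℝ} {a : ℝ}

theorem deriv_eq_zero_of_forall_le (hχ0 : ∀ r ≤ a, χ r = 0) {r : ℝ} (hr : r < a) :
    deriv χ r = 0 := by
  have h : χ =ᶠ[𝓝 r] fun _ => 0 :=
    Filter.mem_of_superset (Iio_mem_nhds hr) fun s hs => hχ0 s (le_of_lt hs)
  simp [h.deriv_eq]

theorem divergence_cutoff_smul (hF : DifferentiableOn ℝ F offAxis) (hχ : Differentiable ℝ χ)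
    (ha : 0 < a) (hχ0 : ∀ r ≤ a, χ r = 0) (x : Coord) :
    divergence (fun y => χ (radius y) • F y) x = χ (radius x) * divergence F x
      + deriv χ (radius x) / radius x * ∑ μ, spatial x μ * F x μ := by
  by_cases hx : 0 < radius x
  · exact divergence_radial_smul hx (hχ _).hasDerivAt
      (hF.differentiableAt (isOpen_offAxis.mem_nhds hx))
  · have hxa : radius x < a := (not_lt.1 hx).trans_lt ha
    have hzero : (fun y => χ (radius y) • F y) =ᶠ[𝓝 x] 0 := by
      filter_upwards [(isOpen_lt continuous_radius continuous_const).mem_nhds hxa] with y hy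
      simp [hχ0 _ (le_of_lt hy)]
    simp [divergence_eq_zero_of_eventuallyEq hzero, hχ0 _ hxa.le,
      deriv_eq_zero_of_forall_le hχ0 hxa]

theorem integrable_cutoff_mul_divergence (hF : ContDiffOn ℝ 1 F offAxis)
    (hc : HasCompactSupport F) (hχ : ContDiff ℝ 1 χ) (ha : 0 < a) (hχ0 : ∀ r ≤ a, χ r = 0) :
    Integrable fun x => χ (radius x) * divergence F x :=
  integrable_of_off_axis ha
    ((hχ.continuous.comp continuous_radius).continuousOn.mul
      (continuousOn_divergence isOpen_offAxis hF))
    (fun x hx => by rw [hχ0 _ hx.le, zero_mul]) (hc.mono' support_divergence_subset).mul_left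

theorem integrable_deriv_cutoff_mul_flux (hF : ContDiffOn ℝ 1 F offAxis)
    (hc : HasCompactSupport F) (hχ : ContDiff ℝ 1 χ) (ha : 0 < a) (hχ0 : ∀ r ≤ a, χ r = 0) :
    Integrable fun x => deriv χ (radius x) / radius x * ∑ μ, spatial x μ * F x μ :=
  integrable_of_off_axis ha
    ((((hχ.continuous_deriv le_rfl).comp continuous_radius).continuousOn.div
      continuous_radius.continuousOn fun x hx => ne_of_gt hx).mul
      (continuousOn_finsetSum _ fun μ _ =>
        (contDiff_spatial (n := 0) μ).continuous.continuousOn.mul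
          (contDiffOn_pi.1 hF μ).continuousOn))
    (fun x hx => by rw [deriv_eq_zero_of_forall_le hχ0 hx, zero_div, zero_mul])
    (hc.mono fun x hx hF0 => hx (by simp [hF0]))

theorem integral_cutoff_mul_divergence (hF : ContDiffOn ℝ 1 F offAxis)
    (hc : HasCompactSupport F) (hχ : ContDiff ℝ 1 χ) (ha : 0 < a) (hχ0 : ∀ r ≤ a, χ r = 0) :
    ∫ x, χ (radius x) * divergence F x =
      -∫ x, deriv χ (radius x) / radius x * ∑ μ, spatial x μ * F x μ := by
  have hprod : ContDiff ℝ 1 fun x => χ (radius x) • F x :=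
    contDiff_of_off_axis ha ((hχ.comp_contDiffOn contDiffOn_radius).smul hF) fun x hx => by
      rw [hχ0 _ hx.le, zero_smul]
  have hsupp : HasCompactSupport fun x => χ (radius x) • F x :=
    hc.mono fun x hx hF0 => hx (by simp [hF0])
  rw [← add_eq_zero_iff_eq_neg,
    ← integral_add (integrable_cutoff_mul_divergence hF hc hχ ha hχ0)
      (integrable_deriv_cutoff_mul_flux hF hc hχ ha hχ0)]
  simp only [← divergence_cutoff_smul (hF.differentiableOn one_ne_zero)
    (hχ.differentiable one_ne_zero) ha hχ0]
  exact integral_divergence_eq_zero hprod hsupp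

end RadialCutoff

end Divergence

/-! ### The flux through a thin cylindrical shell -/

section Dilation

/-- The dilation `(t, x) ↦ (t, b x)`. The reflection `(t, x) ↦ (t, -x)` is the case `b = -1`. -/
def spatialDilation (b : ℝ) : Coord →ₗ[ℝ] Coord := Matrix.toLin' (Matrix.diagonal ![1, b, b, b])

variable (b : ℝ) (x : Coord)

theorem spatialDilation_eq : spatialDilation b x = ![x 0, b * x 1, b * x 2, b * x 3] := by
  funext i
  fin_cases i <;> simp [spatialDilation, Matrix.mulVec_diagonal]

theorem spatial_spatialDilation (μ : Fin 4) :
    spatial (spatialDilation b x) μ = b * spatial x μ := by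
  rw [spatialDilation_eq]
  fin_cases μ <;> simp [spatial]

theorem radius_spatialDilation : radius (spatialDilation b x) = |b| * radius x := by
  rw [spatialDilation_eq, radius, radius, ← Real.sqrt_sq_eq_abs, ← Real.sqrt_mul (sq_nonneg b)]
  congr 1
  simp only [Matrix.cons_val]
  ring

theorem det_spatialDilation : LinearMap.det (spatialDilation b) = b ^ 3 := by
  simp [spatialDilation, LinearMap.det_toLin', Matrix.det_diagonal, Fin.prod_univ_four, pow_succ]

end Dilation

section Cylinder

/-- The solid cylinder of radius `b` around the time axis, of height `2 T`. -/
def cylinder (T b : ℝ) : Set Coord := {x | |x 0| ≤ T ∧ radius x ≤ b}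

variable {T a b : ℝ}

theorem measurableSet_cylinder : MeasurableSet (cylinder T b) :=
  (measurableSet_le (f := fun x : Coord => |x 0|) (by fun_prop) measurable_const).inter
    (measurableSet_le continuous_radius.measurable measurable_const)

theorem abs_spatial_le_radius (x : Coord) (μ : Fin 4) : |spatial x μ| ≤ radius x := by
  refine Real.abs_le_sqrt ?_
  fin_cases μ <;> simp only [spatial] <;> norm_num <;>
    nlinarith [sq_nonneg (x 1), sq_nonneg (x 2), sq_nonneg (x 3)]

theorem volume_cylinder_one_lt_top : volume (cylinder T 1) < ⊤ := by
  suffices h : cylinder T 1 ⊆ Metric.closedBall 0 (max T 1) from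
    (Metric.isBounded_closedBall.subset h).measure_lt_top
  intro x hx
  rw [mem_closedBall_zero_iff, pi_norm_le_iff_of_nonneg (by positivity)]
  have hspatial : ∀ μ, |spatial x μ| ≤ max T 1 := fun μ =>
    (abs_spatial_le_radius x μ).trans (hx.2.trans (le_max_right _ _))
  intro i
  fin_cases i
  exacts [hx.1.trans (le_max_left _ _), hspatial 1, hspatial 2, hspatial 3]

theorem volume_cylinder (hb : 0 < b) :
    volume (cylinder T b) = ENNReal.ofReal (b ^ 3) * volume (cylinder T 1) := by
  have hpre : spatialDilation b ⁻¹' cylinder T b = cylinder T 1 := by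
    ext x
    simp only [cylinder, mem_preimage, mem_ofPred_eq, radius_spatialDilation, abs_of_pos hb]
    exact and_congr (by simp [spatialDilation_eq]) (mul_le_iff_le_one_right hb)
  have h := Measure.addHaar_preimage_linearMap (volume : Measure Coord) (f := spatialDilation b)
    (by rw [det_spatialDilation]; positivity) (cylinder T b)
  rw [hpre, det_spatialDilation, abs_of_pos (by positivity)] at h
  rw [h, ← mul_assoc, ← ENNReal.ofReal_mul (by positivity), mul_inv_cancel₀ (by positivity),
    ENNReal.ofReal_one, one_mul]

/-- The cylindrical shell `a < |x| ≤ b` around the time axis, of height `2 T`. -/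
def shell (T a b : ℝ) : Set Coord := cylinder T b \ cylinder T a

theorem volume_cylinder_ne_top (hb : 0 < b) : volume (cylinder T b) ≠ ⊤ := by
  rw [volume_cylinder hb]
  exact ENNReal.mul_ne_top ENNReal.ofReal_ne_top volume_cylinder_one_lt_top.ne

theorem volume_shell_ne_top (hb : 0 < b) : volume (shell T a b) ≠ ⊤ :=
  ((measure_mono sdiff_subset).trans_lt (volume_cylinder_ne_top hb).lt_top).ne

theorem volume_real_shell (ha : 0 < a) (hab : a ≤ b) :
    volume.real (shell T a b) = (b ^ 3 - a ^ 3) * volume.real (cylinder T 1) := by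
  have hb := ha.trans_le hab
  have hsub : cylinder T a ⊆ cylinder T b := fun x hx => ⟨hx.1, hx.2.trans hab⟩
  rw [shell, measureReal_sdiff hsub measurableSet_cylinder (volume_cylinder_ne_top hb)]
  simp only [Measure.real, volume_cylinder ha, volume_cylinder hb, ENNReal.toReal_mul,
    ENNReal.toReal_ofReal (pow_pos ha 3).le, ENNReal.toReal_ofReal (pow_pos hb 3).le]
  ring

end Cylinder

section Reflection

theorem measurePreserving_reflection : MeasurePreserving (spatialDilation (-1)) := by
  refine ⟨(spatialDilation (-1)).continuous_of_finiteDimensional.measurable, ?_⟩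
  rw [Measure.map_linearMap_addHaar_eq_smul_addHaar _ (by simp [det_spatialDilation]),
    det_spatialDilation]
  simp [Odd.neg_one_pow (by decide : Odd 3)]

theorem integral_comp_reflection (f : Coord → ℝ) :
    ∫ x, f (spatialDilation (-1) x) = ∫ x, f x := by
  have hinv : Function.LeftInverse (spatialDilation (-1)) (spatialDilation (-1)) := fun x => by
    funext i; fin_cases i <;> simp [spatialDilation_eq]
  exact measurePreserving_reflection.integral_comp
    ((spatialDilation (-1)).continuous_of_finiteDimensional.measurableEmbedding hinv.injective) f

theorem two_mul_abs_integral_le_of_reflection {f : Coord → ℝ} (hf : Integrable f) {s : Set Coord}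
    (hs : volume s ≠ ⊤) {C : ℝ} (hC : ∀ x ∈ s, |f x + f (spatialDilation (-1) x)| ≤ C)
    (h0 : ∀ x ∉ s, f x + f (spatialDilation (-1) x) = 0) :
    2 * |∫ x, f x| ≤ C * volume.real s := by
  have hsymm : 2 * ∫ x, f x = ∫ x in s, (f x + f (spatialDilation (-1) x)) := by
    have hf' : Integrable fun x => f (spatialDilation (-1) x) :=
      measurePreserving_reflection.integrable_comp_of_integrable hf
    rw [setIntegral_eq_integral_of_forall_compl_eq_zero h0, integral_add hf hf',
      integral_comp_reflection, two_mul]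
  rw [← abs_two, ← abs_mul, hsymm]
  simp only [← Real.norm_eq_abs] at hC ⊢
  exact norm_setIntegral_le_of_norm_le_const hs.lt_top hC

theorem norm_sub_reflection_le (x : Coord) : ‖x - spatialDilation (-1) x‖ ≤ 2 * radius x := by
  rw [pi_norm_le_iff_of_nonneg (by have := radius_nonneg x; positivity)]
  have hcoord : ∀ i, x i - spatialDilation (-1) x i = 2 * spatial x i := fun i => by
    fin_cases i <;> simp [spatialDilation_eq, spatial, two_mul]
  intro i
  rw [Pi.sub_apply, hcoord, Real.norm_eq_abs, abs_mul, abs_two]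
  exact mul_le_mul_of_nonneg_left (abs_spatial_le_radius x i) zero_le_two

theorem abs_sum_spatial_mul_add_reflection_le {ψ : Coord → Coord} {L : NNReal}
    (hL : LipschitzWith L ψ) (x : Coord) :
    |∑ μ, spatial x μ * ψ x μ
      + ∑ μ, spatial (spatialDilation (-1) x) μ * ψ (spatialDilation (-1) x) μ| ≤
        8 * L * radius x ^ 2 := by
  have hψ : ∀ μ, |ψ x μ - ψ (spatialDilation (-1) x) μ| ≤ L * (2 * radius x) := fun μ =>
    (norm_le_pi_norm (ψ x - ψ (spatialDilation (-1) x)) μ).trans <|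
      (hL.norm_sub_le _ _).trans <|
        mul_le_mul_of_nonneg_left (norm_sub_reflection_le x) L.coe_nonneg
  have hpair : ∑ μ, spatial x μ * ψ x μ
      + ∑ μ, spatial (spatialDilation (-1) x) μ * ψ (spatialDilation (-1) x) μ =
        ∑ μ, spatial x μ * (ψ x μ - ψ (spatialDilation (-1) x) μ) := by
    simp only [spatial_spatialDilation, ← Finset.sum_add_distrib]
    exact Finset.sum_congr rfl fun μ _ => by ring
  calc _ ≤ ∑ μ, |spatial x μ * (ψ x μ - ψ (spatialDilation (-1) x) μ)| :=
        hpair ▸ Finset.abs_sum_le_sum_abs _ _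
    _ ≤ ∑ _μ : Fin 4, radius x * (L * (2 * radius x)) := Finset.sum_le_sum fun μ _ => by
        rw [abs_mul]
        exact mul_le_mul (abs_spatial_le_radius x μ) (hψ μ) (abs_nonneg _) (radius_nonneg x)
    _ = 8 * L * radius x ^ 2 := by
        rw [Finset.sum_const, Finset.card_univ, Fintype.card_fin, nsmul_eq_mul]
        push_cast
        ring

/-- The values of `ψ` at `(t, x)` and `(t, -x)` nearly cancel in the flux, which gains one power
of the radius over the trivial estimate. -/
theorem abs_integral_shell_le {ψ : Coord → Coord} {L : NNReal} (hL : LipschitzWith L ψ) {T : ℝ}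
    (hT : ∀ x, T < |x 0| → ψ x = 0) {h : ℝ → ℝ} {a b H : ℝ} (ha : 0 < a) (hab : a ≤ b)
    (hH : ∀ r ∈ Ioc a b, |h r| ≤ H) (h0 : ∀ r ∉ Ioc a b, h r = 0)
    (hint : Integrable fun x => h (radius x) * ∑ μ, spatial x μ * ψ x μ) :
    |∫ x, h (radius x) * ∑ μ, spatial x μ * ψ x μ| ≤
      4 * H * L * b ^ 2 * ((b ^ 3 - a ^ 3) * volume.real (cylinder T 1)) := by
  have hrad : ∀ x, radius (spatialDilation (-1) x) = radius x := fun x => by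
    rw [radius_spatialDilation, abs_neg, abs_one, one_mul]
  have hon : ∀ x ∈ shell T a b, |h (radius x) * ∑ μ, spatial x μ * ψ x μ
      + h (radius (spatialDilation (-1) x)) * ∑ μ, spatial (spatialDilation (-1) x) μ
        * ψ (spatialDilation (-1) x) μ| ≤ H * (8 * L * b ^ 2) := fun x hx => by
    have hr : radius x ∈ Ioc a b := ⟨not_le.1 fun hxa => hx.2 ⟨hx.1.1, hxa⟩, hx.1.2⟩
    have hH0 : 0 ≤ H := (abs_nonneg _).trans (hH _ hr)
    rw [hrad, ← mul_add, abs_mul]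
    refine mul_le_mul (hH _ hr) ((abs_sum_spatial_mul_add_reflection_le hL x).trans ?_)
      (abs_nonneg _) hH0
    have := radius_nonneg x
    gcongr
    exact hr.2
  have hoff : ∀ x ∉ shell T a b, h (radius x) * ∑ μ, spatial x μ * ψ x μ
      + h (radius (spatialDilation (-1) x)) * ∑ μ, spatial (spatialDilation (-1) x) μ
        * ψ (spatialDilation (-1) x) μ = 0 := fun x hx => by
    by_cases hr : radius x ∈ Ioc a b
    · have ht : T < |x 0| :=
        not_le.1 fun ht => hx ⟨⟨ht, hr.2⟩, fun hxa => absurd hxa.2 (not_le.2 hr.1)⟩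
      have ht' : T < |spatialDilation (-1) x 0| := by simpa [spatialDilation_eq] using ht
      simp [hT _ ht, hT _ ht']
    · simp [hrad, h0 _ hr]
  have hmain := two_mul_abs_integral_le_of_reflection hint
    (volume_shell_ne_top (ha.trans_le hab)) hon hoff
  rw [volume_real_shell ha hab] at hmain
  linarith

end Reflection

/-! ### The limit at the axis -/

section Cutoff

/-- A smooth cutoff which increases from `0` at `a` to `1` at `b`. -/
def cutoff (a b r : ℝ) : ℝ := Real.smoothTransition ((r - a) / (b - a))

variable {a b r : ℝ}

theorem cutoff_mem_Icc (a b r : ℝ) : cutoff a b r ∈ Icc 0 1 :=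
  ⟨Real.smoothTransition.nonneg _, Real.smoothTransition.le_one _⟩

theorem cutoff_eq_zero (hab : a < b) (hr : r ≤ a) : cutoff a b r = 0 :=
  Real.smoothTransition.zero_of_nonpos
    (div_nonpos_of_nonpos_of_nonneg (sub_nonpos.2 hr) (sub_nonneg.2 hab.le))

theorem cutoff_eq_one (hab : a < b) (hr : b ≤ r) : cutoff a b r = 1 :=
  Real.smoothTransition.one_of_one_le
    ((one_le_div (sub_pos.2 hab)).2 (sub_le_sub_right hr a))

theorem contDiff_cutoff {n : ℕ∞} : ContDiff ℝ n (cutoff a b) :=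
  Real.smoothTransition.contDiff.comp ((contDiff_id.sub contDiff_const).div_const _)

theorem deriv_cutoff_eq_zero (hab : a < b) (hr : r ∉ Ioc a b) : deriv (cutoff a b) r = 0 := by
  rcases not_and_or.1 hr with hr | hr
  · refine IsLocalMin.deriv_eq_zero (.of_forall fun s => ?_)
    rw [cutoff_eq_zero hab (not_lt.1 hr)]
    exact (cutoff_mem_Icc a b s).1
  · refine IsLocalMax.deriv_eq_zero (.of_forall fun s => ?_)
    rw [cutoff_eq_one hab (not_le.1 hr).le]
    exact (cutoff_mem_Icc a b s).2

theorem deriv_cutoff (a b r : ℝ) :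
    deriv (cutoff a b) r = deriv (cutoff 0 1) ((r - a) / (b - a)) / (b - a) := by
  have hcutoff : cutoff a b = fun s => cutoff 0 1 ((s - a) / (b - a)) := by
    simp [cutoff, funext_iff]
  have houter := (contDiff_cutoff (a := 0) (b := 1) (n := 1)).differentiable one_ne_zero
    ((r - a) / (b - a))
  have hinner := ((hasDerivAt_id' r).sub_const a).div_const (b - a)
  rw [hcutoff]
  exact (houter.hasDerivAt.comp r hinner).deriv.trans (mul_one_div _ _)

theorem exists_abs_deriv_cutoff_le :
    ∃ S, ∀ a b r : ℝ, a < b → |deriv (cutoff a b) r| ≤ S / (b - a) := by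
  have hsupp : HasCompactSupport (deriv (cutoff 0 1)) :=
    .intro (isCompact_Icc (a := (0 : ℝ)) (b := 1)) fun r hr =>
      deriv_cutoff_eq_zero one_pos fun h => hr (Ioc_subset_Icc_self h)
  obtain ⟨S, hS⟩ := (contDiff_cutoff.continuous_deriv le_rfl).bounded_above_of_compact_support hsupp
  refine ⟨S, fun a b r hab => ?_⟩
  rw [deriv_cutoff, abs_div, abs_of_pos (sub_pos.2 hab)]
  exact div_le_div_of_nonneg_right (hS _) (sub_pos.2 hab).le

end Cutoff

section OuterRegion

theorem measurableSet_outerRegion {ε : ℝ} : MeasurableSet (outerRegion ε) :=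
  measurableSet_le measurable_const continuous_radius.measurable

theorem integrableOn_outerRegion {g : Coord → ℝ} (hg : ContinuousOn g offAxis)
    (hc : HasCompactSupport g) {ε : ℝ} (hε : 0 < ε) : IntegrableOn g (outerRegion ε) := by
  have hclosed : IsClosed (outerRegion ε) := isClosed_le continuous_const continuous_radius
  have hcompact : IntegrableOn g (outerRegion ε ∩ tsupport g) :=
    (hg.mono fun x hx => hε.trans_le hx.1).integrableOn_compact (hc.inter_left hclosed)
  exact hcompact.of_forall_sdiff_eq_zero measurableSet_outerRegion fun x hx =>
    image_eq_zero_of_notMem_tsupport fun hxg => hx.2 ⟨hx.1, hxg⟩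

theorem tendsto_integral_cutoff {g : Coord → ℝ} {a ε : ℝ} (haε : a < ε)
    (hg : IntegrableOn g (outerRegion a)) :
    Tendsto (fun e => ∫ x, cutoff e ε (radius x) * g x) (𝓝[<] ε)
      (𝓝 (∫ x in outerRegion ε, g x)) := by
  have hg' := hg.integrable_indicator measurableSet_outerRegion
  have hind : ∀ᶠ e in 𝓝[<] ε, ∀ x, cutoff e ε (radius x) * g x =
      cutoff e ε (radius x) * (outerRegion a).indicator g x := by
    filter_upwards [Ioo_mem_nhdsLT haε] with e he x
    by_cases hx : x ∈ outerRegion a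
    · rw [indicator_of_mem hx]
    · rw [cutoff_eq_zero he.2 ((not_le.1 hx).trans he.1).le, zero_mul, zero_mul]
  rw [← integral_indicator measurableSet_outerRegion]
  refine tendsto_integral_filter_of_dominated_convergence
    (fun x => ‖(outerRegion a).indicator g x‖) ?_ ?_ hg'.norm (ae_of_all _ fun x => ?_)
  · filter_upwards [hind] with e he
    simp only [he]
    exact ((contDiff_cutoff (n := 0)).continuous.comp
      continuous_radius).aestronglyMeasurable.mul hg'.aestronglyMeasurable
  · filter_upwards [hind] with e he
    refine ae_of_all _ fun x => ?_
    rw [he x, norm_mul, Real.norm_of_nonneg (cutoff_mem_Icc e ε _).1]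
    exact mul_le_of_le_one_left (norm_nonneg _) (cutoff_mem_Icc e ε _).2
  · refine tendsto_const_nhds.congr' ?_
    by_cases hx : ε ≤ radius x
    · filter_upwards [self_mem_nhdsWithin] with e he
      rw [indicator_of_mem (show x ∈ outerRegion ε from hx), cutoff_eq_one he hx, one_mul]
    · filter_upwards [Ioo_mem_nhdsLT (not_le.1 hx)] with e he
      rw [indicator_of_notMem (show x ∉ outerRegion ε from hx), cutoff_eq_zero he.2 he.1.le,
        zero_mul]

theorem aecover_outerRegion : AECover volume (𝓝[>] 0) outerRegion := by
  refine ⟨?_, fun _ => measurableSet_outerRegion⟩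
  have hplane : ∀ᵐ x : Coord, x 1 ≠ 0 := by
    rw [ae_iff]
    simpa [volume_pi] using Measure.pi_hyperplane (fun _ : Fin 4 => (volume : Measure ℝ)) 1 0
  filter_upwards [hplane] with x hx
  have hpos : 0 < radius x := (abs_pos.2 hx).trans_le (abs_spatial_le_radius x 1)
  filter_upwards [Ioo_mem_nhdsGT hpos] with ε hε using hε.2.le

end OuterRegion

section AxisLimit

variable {F ψ : Coord → Coord} {q : ℝ → ℝ} {L : NNReal} {T S m ε : ℝ}

theorem abs_div_mul_le_of_abs_cube_mul_le {r a d D q : ℝ} (ha : 0 < a) (hr : a ≤ r)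
    (hd : |d| ≤ D) (hm : |r ^ 3 * q| ≤ m) : |d / r * q| ≤ D * m / a ^ 4 := by
  have hr0 : 0 < r := ha.trans_le hr
  have hm0 : 0 ≤ m := (abs_nonneg _).trans hm
  have hD0 : 0 ≤ D := (abs_nonneg _).trans hd
  calc |d / r * q| = |d| * |r ^ 3 * q| / r ^ 4 := by
        rw [abs_mul, abs_mul, abs_div, abs_of_pos hr0, abs_of_pos (pow_pos hr0 3)]
        field_simp
    _ ≤ D * m / a ^ 4 := by gcongr

theorem abs_integral_cutoff_mul_divergence_le (hF : ContDiffOn ℝ 1 F offAxis)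
    (hc : HasCompactSupport F)
    (hflux : ∀ x, 0 < radius x →
      ∑ μ, spatial x μ * F x μ = q (radius x) * ∑ μ, spatial x μ * ψ x μ)
    (hL : LipschitzWith L ψ) (hT : ∀ x, T < |x 0| → ψ x = 0)
    (hS : ∀ a b r : ℝ, a < b → |deriv (cutoff a b) r| ≤ S / (b - a)) {e : ℝ} (he : 0 < e)
    (hεe : ε ≤ 2 * e) (heε : e < ε) (hm : ∀ r ∈ Ioc e ε, |r ^ 3 * q r| ≤ m) :
    |∫ x, cutoff e ε (radius x) * divergence F x| ≤
      192 * S * L * volume.real (cylinder T 1) * m := by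
  have hε := he.trans heε
  have hshell : ∀ x, deriv (cutoff e ε) (radius x) / radius x * ∑ μ, spatial x μ * F x μ =
      deriv (cutoff e ε) (radius x) / radius x * q (radius x) * ∑ μ, spatial x μ * ψ x μ :=
    fun x => by
    by_cases hx : radius x ∈ Ioc e ε
    · rw [hflux x (he.trans hx.1), mul_assoc]
    · simp [deriv_cutoff_eq_zero heε hx]
  have hweight : ∀ r ∈ Ioc e ε,
      |deriv (cutoff e ε) r / r * q r| ≤ S / (ε - e) * m / (ε / 2) ^ 4 := fun r hr =>
    abs_div_mul_le_of_abs_cube_mul_le (half_pos hε) (by linarith [hr.1]) (hS e ε r heε) (hm r hr)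
  have hint := integrable_deriv_cutoff_mul_flux hF hc contDiff_cutoff he
    fun r hr => cutoff_eq_zero heε hr
  rw [integral_cutoff_mul_divergence hF hc contDiff_cutoff he fun r hr => cutoff_eq_zero heε hr,
    abs_neg]
  simp only [hshell] at hint ⊢
  refine (abs_integral_shell_le hL hT he heε.le hweight
    (fun r hr => by simp [deriv_cutoff_eq_zero heε hr]) hint).trans ?_
  have hm0 : 0 ≤ m := (abs_nonneg _).trans (hm ε ⟨heε, le_rfl⟩)
  have hS0 : 0 ≤ S := by simpa using (abs_nonneg _).trans (hS 0 1 0 one_pos)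
  have hthin : ε ^ 3 - e ^ 3 ≤ 3 * ε ^ 2 * (ε - e) := by
    nlinarith [mul_nonneg (sq_nonneg (ε - e)) (by linarith : 0 ≤ 2 * ε + e)]
  have hεe' := sub_pos.2 heε
  calc _ ≤ 4 * (S / (ε - e) * m / (ε / 2) ^ 4) * L * ε ^ 2 *
        (3 * ε ^ 2 * (ε - e) * volume.real (cylinder T 1)) := by gcongr
    _ = 192 * S * L * volume.real (cylinder T 1) * m := by
        field_simp
        ring

theorem tendsto_integral_divergence (hF : ContDiffOn ℝ 1 F offAxis) (hc : HasCompactSupport F)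
    (hψ : ContDiff ℝ 1 ψ) (hψc : HasCompactSupport ψ)
    (hflux : ∀ x, 0 < radius x →
      ∑ μ, spatial x μ * F x μ = q (radius x) * ∑ μ, spatial x μ * ψ x μ)
    (hq : Tendsto (fun r => r ^ 3 * q r) (𝓝[>] 0) (𝓝 0)) :
    Tendsto (fun ε => ∫ x in outerRegion ε, divergence F x) (𝓝[>] 0) (𝓝 0) := by
  obtain ⟨L, hL⟩ := hψ.lipschitzWith_of_hasCompactSupport hψc one_ne_zero
  obtain ⟨T, hT⟩ : ∃ T, ∀ x, T < |x 0| → ψ x = 0 := by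
    obtain ⟨T, hT⟩ := hψc.isCompact.isBounded.exists_norm_le
    exact ⟨T, fun x hx => image_eq_zero_of_notMem_tsupport fun hxψ =>
      absurd ((norm_le_pi_norm x 0).trans (hT x hxψ)) (not_le.2 hx)⟩
  obtain ⟨S, hS⟩ := exists_abs_deriv_cutoff_le
  have hint : ∀ {ε}, 0 < ε → IntegrableOn (divergence F) (outerRegion ε) :=
    integrableOn_outerRegion (continuousOn_divergence isOpen_offAxis hF)
      (hc.mono' support_divergence_subset)
  refine Metric.tendsto_nhds.2 fun η hη => ?_
  obtain ⟨m, hm, hmη⟩ := exists_pos_mul_lt hη (192 * S * L * volume.real (cylinder T 1))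
  obtain ⟨δ, hδ, hqδ⟩ := mem_nhdsGT_iff_exists_Ioo_subset.1 (Metric.tendsto_nhds.1 hq m hm)
  filter_upwards [Ioo_mem_nhdsGT hδ] with ε hε
  rw [dist_zero_right]
  refine lt_of_le_of_lt ?_ hmη
  refine le_of_tendsto (tendsto_integral_cutoff (half_lt_self hε.1) (hint (half_pos hε.1))).norm ?_
  filter_upwards [Ioo_mem_nhdsLT (half_lt_self hε.1)] with e he
  have he0 : 0 < e := (half_pos hε.1).trans he.1
  refine abs_integral_cutoff_mul_divergence_le hF hc hflux hL hT hS he0 (by linarith [he.1]) he.2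
    fun r hr => ?_
  have hr : dist (r ^ 3 * q r) 0 < m := hqδ ⟨he0.trans hr.1, hr.2.trans_lt hε.2⟩
  rw [dist_zero_right] at hr
  exact hr.le

end AxisLimit

/-! ### Decay conditions and the weak Bianchi identity -/

section WeightedEinstein

variable {c r γ : ℝ} {α β : ℝ → ℝ}

theorem exp_sub_eq_mul_exp_add (a b : ℝ) :
    Real.exp (a - b) = Real.exp (-(2 * b)) * Real.exp (a + b) := by
  rw [← Real.exp_add]
  ring_nf

theorem isBigO_abs_add_abs_add_abs_iff {ι : Type*} {l : Filter ι} {f g h k : ι → ℝ} :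
    (fun x => |f x| + |g x| + |h x|) =O[l] k ↔ f =O[l] k ∧ g =O[l] k ∧ h =O[l] k := by
  refine ⟨fun H => ?_, fun ⟨hf, hg, hh⟩ => (hf.norm_left.add hg.norm_left).add hh.norm_left⟩
  refine ⟨?_, ?_, ?_⟩ <;> refine (Asymptotics.isBigO_of_le l fun x => ?_).trans H <;>
    rw [Real.norm_eq_abs, Real.norm_of_nonneg (by positivity)] <;>
    linarith [abs_nonneg (f x), abs_nonneg (g x), abs_nonneg (h x)]

theorem weighted_sphericalEinstein_tt (hc : c ≠ 0) (hα : ContDiffOn ℝ 2 α (Ioi 0))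
    (hβ : ContDiffOn ℝ 2 β (Ioi 0)) (hr : 0 < r) :
    r ^ 3 * sphericalEinstein c α β 0 0 r * Real.exp (α r + β r) =
      r * Real.exp (α r - β r) * (1 - Real.exp (2 * β r) - 2 * r * deriv β r) := by
  rw [sphericalEinstein_eq hc hα hβ hr, exp_sub_eq_mul_exp_add]
  simp only [Matrix.cons_val, einsteinTT]
  field_simp

theorem weighted_sphericalEinstein_rr (hc : c ≠ 0) (hα : ContDiffOn ℝ 2 α (Ioi 0))
    (hβ : ContDiffOn ℝ 2 β (Ioi 0)) (hr : 0 < r) :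
    r ^ 3 * sphericalEinstein c α β 1 1 r * Real.exp (α r + β r) =
      r * Real.exp (α r - β r) * (1 - Real.exp (2 * β r) + 2 * r * deriv α r) := by
  rw [sphericalEinstein_eq hc hα hβ hr, exp_sub_eq_mul_exp_add]
  simp only [Matrix.cons_val, einsteinRR]
  field_simp

theorem weighted_sphericalEinstein_thetaTheta (hc : c ≠ 0) (hα : ContDiffOn ℝ 2 α (Ioi 0))
    (hβ : ContDiffOn ℝ 2 β (Ioi 0)) (hr : 0 < r) :
    r ^ 3 * sphericalEinstein c α β 2 2 r * Real.exp (α r + β r) =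
      r ^ 2 * Real.exp (α r - β r) *
        ((1 + r * deriv α r) * (deriv α r - deriv β r) + r * deriv (deriv α) r) := by
  rw [sphericalEinstein_eq hc hα hβ hr, exp_sub_eq_mul_exp_add]
  simp only [Matrix.cons_val, einsteinAngular]
  field_simp

theorem einsteinDecay_iff (hc : c ≠ 0) (hα : ContDiffOn ℝ 2 α (Ioi 0))
    (hβ : ContDiffOn ℝ 2 β (Ioi 0)) :
    EinsteinDecay c α β γ ↔ DecayTT α β γ ∧ DecayRR α β γ ∧ DecayThetaTheta α β γ := by
  unfold EinsteinDecay DecayTT DecayRR DecayThetaTheta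
  rw [← isBigO_abs_add_abs_add_abs_iff]
  refine Asymptotics.isBigO_congr ?_ .rfl
  filter_upwards [self_mem_nhdsWithin] with r hr
  have hr : 0 < r := hr
  rw [← weighted_sphericalEinstein_tt hc hα hβ hr, ← weighted_sphericalEinstein_rr hc hα hβ hr,
    ← weighted_sphericalEinstein_thetaTheta hc hα hβ hr]
  simp only [abs_mul, abs_of_pos (pow_pos hr 3), Real.abs_exp]
  ring

theorem DecayRR.tendsto (h : DecayRR α β γ) (hc : c ≠ 0)
    (hα : ContDiffOn ℝ 2 α (Ioi 0)) (hβ : ContDiffOn ℝ 2 β (Ioi 0)) (hγ : 0 < γ) :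
    Tendsto (fun r => r ^ 3 * sphericalEinstein c α β 1 1 r * Real.exp (α r + β r)) (𝓝[>] 0)
      (𝓝 0) := by
  have hpow : Tendsto (fun r : ℝ => r ^ γ) (𝓝[>] 0) (𝓝 0) :=
    tendsto_nhdsWithin_of_tendsto_nhds <| by
      simpa [Real.zero_rpow hγ.ne'] using (Real.continuousAt_rpow_const 0 γ (.inr hγ.le)).tendsto
  refine (h.trans_tendsto hpow).congr' ?_
  filter_upwards [self_mem_nhdsWithin] with r hr
  exact (weighted_sphericalEinstein_rr hc hα hβ hr).symm

end WeightedEinstein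

theorem eLpNorm_exp_le_of_monotoneOn {f : ℝ → ℝ} {ε : ℝ} (hε : 0 < ε)
    (hf : MonotoneOn f (Ioc 0 ε)) :
    eLpNorm (fun r => Real.exp (f r)) ⊤ (volume.restrict (Ioc 0 ε)) ≤
      ENNReal.ofReal (Real.exp (f ε)) := by
  rw [eLpNorm_exponent_top]
  refine eLpNormEssSup_le_of_ae_bound ?_
  filter_upwards [ae_restrict_mem measurableSet_Ioc] with r hr
  rw [Real.norm_eq_abs, Real.abs_exp, Real.exp_le_exp]
  exact hf hr ⟨hε, le_rfl⟩ hr.2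

theorem radialLimit_of_monotoneOn {c δ : ℝ} {α β : ℝ → ℝ}
    (h : Tendsto (fun r => r ^ 3 * sphericalEinstein c α β 1 1 r * Real.exp (α r + β r))
      (𝓝[>] 0) (𝓝 0))
    (hδ : 0 < δ) (hmono : MonotoneOn (fun r => α r + β r) (Ioc 0 δ)) : RadialLimit c α β := by
  have hlim := ENNReal.tendsto_ofReal h.abs
  rw [abs_zero, ENNReal.ofReal_zero] at hlim
  refine tendsto_of_tendsto_of_tendsto_of_le_of_le' tendsto_const_nhds hlim
    (.of_forall fun _ => zero_le) ?_
  filter_upwards [Ioo_mem_nhdsGT hδ] with ε hε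
  refine (mul_le_mul_right (eLpNorm_exp_le_of_monotoneOn hε.1
    (hmono.mono (Ioc_subset_Ioc_right hε.2.le))) _).trans_eq ?_
  rw [← ENNReal.ofReal_mul (abs_nonneg _), abs_mul _ (Real.exp _), Real.abs_exp]

theorem weakBianchi_of_tendsto {c : ℝ} (hc : c ≠ 0) {α β : ℝ → ℝ}
    (hα : ContDiffOn ℝ 3 α (Ioi 0)) (hβ : ContDiffOn ℝ 2 β (Ioi 0))
    (h : Tendsto (fun r => r ^ 3 * sphericalEinstein c α β 1 1 r * Real.exp (α r + β r))
      (𝓝[>] 0) (𝓝 0)) : WeakBianchi c α β := by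
  intro ψ hψ hψc
  have hψ₁ : ContDiff ℝ 1 ψ := hψ.of_le (by exact_mod_cast le_top)
  have hF := contDiffOn_einsteinFlux hα hβ hψ₁
  have hFc : HasCompactSupport (einsteinFlux α β ψ) :=
    hψc.mono (support_einsteinFlux_subset α β ψ)
  have heq : ∀ {ε}, 0 < ε → EqOn (bianchiIntegrand c α β ψ)
      (fun x => |c| * divergence (einsteinFlux α β ψ) x) (outerRegion ε) := fun hε x hx =>
    bianchiIntegrand_eq_divergence hc hα hβ (hε.trans_le hx) (hψ₁.differentiable one_ne_zero x)
  have hq : Tendsto (fun r => r ^ 3 * (Real.exp (α r + β r) * einsteinRR α β r)) (𝓝[>] 0)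
      (𝓝 0) := by
    refine h.congr' ?_
    filter_upwards [self_mem_nhdsWithin] with r hr
    rw [sphericalEinstein_eq hc (hα.of_le (by norm_num)) hβ hr, mul_assoc, mul_comm (Real.exp _)]
    rfl
  have hlim : Tendsto (fun ε => ∫ x in outerRegion ε, bianchiIntegrand c α β ψ x) (𝓝[>] 0)
      (𝓝 0) := by
    have hdiv := (tendsto_integral_divergence hF hFc hψ₁ hψc
      (fun x hx => sum_spatial_mul_einsteinFlux α β ψ hx) hq).const_mul |c|
    rw [mul_zero] at hdiv
    refine hdiv.congr' ?_
    filter_upwards [self_mem_nhdsWithin] with ε hε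
    rw [setIntegral_congr_fun measurableSet_outerRegion (heq hε), integral_const_mul]
  refine ⟨fun ε hε => ?_, hlim, fun hint => tendsto_nhds_unique
    (aecover_outerRegion.integral_tendsto_of_countably_generated hint) hlim⟩
  refine IntegrableOn.congr_fun ?_ (heq hε).symm measurableSet_outerRegion
  exact (integrableOn_outerRegion (continuousOn_divergence isOpen_offAxis hF)
    (hFc.mono' support_divergence_subset) hε).const_mul |c|

end StaticBianchi

end

open StaticBianchi in
theorem corollary2p2_general {c : ℝ} (hc : c ≠ 0) {α β : ℝ → ℝ}
    (hα : ContDiffOn ℝ 3 α (Set.Ioi 0)) (hβ : ContDiffOn ℝ 2 β (Set.Ioi 0)) :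
    (Tendsto (fun r => r ^ 3 * sphericalEinstein c α β 1 1 r * Real.exp (α r + β r))
      (𝓝[>] 0) (𝓝 0) → WeakBianchi c α β) ∧
    (∀ γ, EinsteinDecay c α β γ ↔ DecayTT α β γ ∧ DecayRR α β γ ∧ DecayThetaTheta α β γ) ∧
    (∀ γ, 0 < γ → DecayRR α β γ →
      Tendsto (fun r => r ^ 3 * sphericalEinstein c α β 1 1 r * Real.exp (α r + β r))
        (𝓝[>] 0) (𝓝 0)) ∧
    (Tendsto (fun r => r ^ 3 * sphericalEinstein c α β 1 1 r * Real.exp (α r + β r))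
      (𝓝[>] 0) (𝓝 0) →
      (∃ δ, 0 < δ ∧ MonotoneOn (fun r => α r + β r) (Set.Ioc 0 δ)) → RadialLimit c α β) :=
  ⟨weakBianchi_of_tendsto hc hα hβ, fun _ => einsteinDecay_iff hc (hα.of_le (by norm_num)) hβ,
    fun _ hγ h => h.tendsto hc (hα.of_le (by norm_num)) hβ hγ,
    fun h ⟨_, hδ, hmono⟩ => radialLimit_of_monotoneOn h hδ hmono⟩

theorem corollary2p2 (c : ℝ) (hc : 0 < c) (α β : ℝ → ℝ)
    (hα : ContDiffOn ℝ 3 α (Set.Ioi 0)) (hβ : ContDiffOn ℝ 3 β (Set.Ioi 0)) :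
    -- decay of the Einstein tensor gives the weak Bianchi identity
    ((∃ γ : ℝ, 0 < γ ∧ StaticBianchi.EinsteinDecay c α β γ) →
      StaticBianchi.RadialLimit c α β → StaticBianchi.WeakBianchi c α β) ∧
    -- the decay of the Einstein tensor in terms of `α` and `β`
    (∀ γ : ℝ, 0 < γ → (StaticBianchi.EinsteinDecay c α β γ ↔
      (StaticBianchi.DecayTT α β γ ∧ StaticBianchi.DecayRR α β γ ∧
        StaticBianchi.DecayThetaTheta α β γ))) ∧
    ((∃ γ : ℝ, 0 < γ ∧ StaticBianchi.DecayTT α β γ ∧ StaticBianchi.DecayRR α β γ ∧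
        StaticBianchi.DecayThetaTheta α β γ) →
      StaticBianchi.RadialLimit c α β → StaticBianchi.WeakBianchi c α β) ∧
    -- if `α + β` decreases as `r ↓ 0`, the limit condition is automatic
    (∀ γ : ℝ, 0 < γ → StaticBianchi.DecayRR α β γ →
      (∃ δ : ℝ, 0 < δ ∧ MonotoneOn (fun r => α r + β r) (Set.Ioc 0 δ)) →
      StaticBianchi.RadialLimit c α β) := by
  obtain ⟨hweak, hiff, hlim, hradial⟩ := corollary2p2_general hc.ne' hα (hβ.of_le (by norm_num))
  exact ⟨fun ⟨γ, hγ, h⟩ _ => hweak (hlim γ hγ ((hiff γ).1 h).2.1), fun γ _ => hiff γ,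
    fun ⟨γ, hγ, _, h, _⟩ _ => hweak (hlim γ hγ h), fun γ hγ h => hradial (hlim γ hγ h)⟩
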